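/- Let $K$ be a field with $\frac16\in K$ (that is, $6\neq 0$ in $K$), let $n$ be a positive integer, $x=(x_1,\dots,x_n)$, and let $H=(H_1,\dots,H_n)\in K[x]^n$ be cubic homogeneous (every $H_i$ is zero or homogeneous of degree $3$), such that the Jacobian matrix $\mathcal JH=(\partial H_i/\partial x_j)_{i,j}$ is nilpotent. Let $\operatorname{rk}\mathcal JH$ be its rank over $K(x)$. (i) If $\operatorname{rk}\mathcal JH=1$, then there exists a $T\in\operatorname{GL}_n(K)$ such that for $\tilde H:=T^{-1}H(Tx)$, $$\tilde H_1\in K[x_2,x_3,\dots,x_n],\qquad \tilde H_2=\tilde H_3=\cdots=\tilde H_n=0.$$ (ii) If $\operatorname{rk}\mathcal JH=2$ and $\mathcal JH$ is not similar over $K$ to a triangular matrix (that is, $T^{-1}(\mathcal JH)T$ is not triangular for any $T\in\operatorname{GL}_n(K)$), then $n\ge 4$ and there exists a $T\in\operatorname{GL}_n(K)$ such that for $\tilde H:=T^{-1}H(Tx)$, $$\tilde H_1-(x_1x_3x_4-x_2x_4^2)\in K[x_3,x_4,\dots,x_n],$$ $$\tilde H_2-(x_1x_3^2-x_2x_3x_4)\in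 K[x_3,x_4,\dots,x_n],$$ $$\tilde H_3=\tilde H_4=\cdots=\tilde H_n=0.$$ Furthermore, if $\operatorname{rk}\mathcal JH\le 2$, then $x+H$ is invertible, i.e. it has a two-sided inverse polynomial map over $K$. Moreover, $x+H$ is even tame if either $\operatorname{rk}\mathcal JH=1$, or $\operatorname{rk}\mathcal JH=2$ and $n\ge5$. Here a polynomial map is tame if it is a finite composition of invertible affine maps over $K$ and elementary maps $(x_1,\dots,x_{i-1},x_i+f,x_{i+1},\dots,x_n)$ with $f\in K[x]$ not involving $x_i$. -/

import Mathlib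

open MvPolynomial

/-- A polynomial map `H = (H_1, …, H_n) ∈ K[x_1, …, x_n]^n`. The variable `x_{i+1}` and the
component `H_{i+1}` have index `i : Fin n`. -/
abbrev PolyMap (n : ℕ) (K : Type*) [Field K] : Type _ := Fin n → MvPolynomial (Fin n) K

namespace PolyMap

variable {n : ℕ} {K : Type*} [Field K]

/-- The composition `F ∘ G`, that is, `F(G(x))`. -/
noncomputable def comp (F G : PolyMap n K) : PolyMap n K := fun i => bind₁ G (F i)

/-- The affine polynomial map `A x + b`. -/
noncomputable def affine (A : Matrix (Fin n) (Fin n) K) (b : Fin n → K) : PolyMap n K :=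
  fun i => ∑ j, C (A i j) * X j + C (b i)

/-- The linear polynomial map `A x`. -/
noncomputable def linear (A : Matrix (Fin n) (Fin n) K) : PolyMap n K :=
  fun i => ∑ j, C (A i j) * X j

/-- The Jacobian matrix, with entry `∂ H_i / ∂ x_j` at position `(i, j)`. -/
noncomputable def jacobian (H : PolyMap n K) :
    Matrix (Fin n) (Fin n) (MvPolynomial (Fin n) K) :=
  Matrix.of fun i j => pderiv j (H i)

/-- The rank of the Jacobian matrix over the field of rational functions `K(x)`. -/
noncomputable def jacobianRank (H : PolyMap n K) : ℕ :=
  ((jacobian H).map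
    (algebraMap (MvPolynomial (Fin n) K) (FractionRing (MvPolynomial (Fin n) K)))).rank

/-- The linear conjugate `T⁻¹ H(T x)` of `H`. -/
noncomputable def conj (T : Matrix.GeneralLinearGroup (Fin n) K) (H : PolyMap n K) :
    PolyMap n K :=
  (linear ((T⁻¹ : Matrix.GeneralLinearGroup (Fin n) K) : Matrix (Fin n) (Fin n) K)).comp
    (H.comp (linear (T : Matrix (Fin n) (Fin n) K)))

/-- A square matrix is triangular if it is upper or lower triangular. -/
def IsTriangular {R : Type*} [Zero R] (M : Matrix (Fin n) (Fin n) R) : Prop :=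
  (∀ i j, j < i → M i j = 0) ∨ (∀ i j, i < j → M i j = 0)

/-- A polynomial matrix `M` is similar over `K` to a triangular matrix: `T⁻¹ M T` is triangular
for some `T ∈ GL_n(K)`. -/
def SimilarToTriangular (M : Matrix (Fin n) (Fin n) (MvPolynomial (Fin n) K)) : Prop :=
  ∃ T : Matrix.GeneralLinearGroup (Fin n) K,
    IsTriangular
      (((T⁻¹ : Matrix.GeneralLinearGroup (Fin n) K) : Matrix (Fin n) (Fin n) K).map C * M *
        (T : Matrix (Fin n) (Fin n) K).map C)

/-- The polynomial map `F` is invertible: it has a two-sided inverse polynomial map. -/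
def IsInvertible (F : PolyMap n K) : Prop :=
  ∃ G : PolyMap n K, F.comp G = X ∧ G.comp F = X

/-- Tame polynomial maps: finite compositions of invertible affine maps and elementary maps
`(x_1, …, x_{i-1}, x_i + f, x_{i+1}, …, x_n)` where `x_i` does not occur in `f`. Inverses of
such generators are again such generators, so this is the tame automorphism group. -/
inductive IsTame : PolyMap n K → Prop
  | affine (T : Matrix.GeneralLinearGroup (Fin n) K) (b : Fin n → K) :
      IsTame (PolyMap.affine (T : Matrix (Fin n) (Fin n) K) b)
  | elementary (i : Fin n) (f : MvPolynomial (Fin n) K) (hf : f ∈ supported K {j | j ≠ i}) :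
      IsTame (Function.update X i (X i + f))
  | comp {F G : PolyMap n K} (hF : IsTame F) (hG : IsTame G) : IsTame (PolyMap.comp F G)

end PolyMap

/-! Because `6 ≠ 0`, the integers 1, 2, 3, 4 are invertible in `K`, so polynomials of degree at most
4 can be handled by derivatives as in characteristic zero. Everything in rank at most two rests on
one dichotomy, `similarToTriangular_or_isNormalForm`: the Jacobian is triangularizable, or `H` is
linearly conjugate to the normal form. The argument splits on the dimension over `K` of the span of
the components of `H`.

If this dimension is at most 2, a conjugation leaves only `H₁` and `H₂`. Nilpotency gives their 2×2
Jacobian block trace and determinant zero, so unique factorization writes its entries as `kαβ`,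
`kβ²`, `-kα²`, `-kαβ` with `α`, `β` coprime of equal degree 0 or 1. In degree 0 the columns are
proportional over `K` and the Jacobian triangularizes. In degree 1, equality of mixed partials frees
`α` and `β` of `x₁`, `x₂`; they are independent linear forms, and taking them as coordinates gives
the normal form.

If the dimension is at least 3, the rank condition and Euler's formula make `f × ∂ₖf = Pₖ c` for
three independent components `f`, with `P` primitive. A third-order computation
(`dvd_derivation_of_prime`) shows that `P(v)` divides its own derivative in direction `v`; by degree
that derivative vanishes for constant `v`. Hence `P` has a constant skew Jacobian, and integrability
`P ∧ dP = 0` leaves only two independent coefficients (`exists_pencil`). After a conjugation all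
ratios `H_a / H_b` depend only on `x₁`, `x₂`, so `H = G h` with `h` in these two variables. The
dimension bound forces `deg G ≤ 1`, and trace conditions then triangularize the Jacobian.

Triangular maps are tame. In the normal form `x₁x₃ - x₂x₄` is preserved up to the summands in `x₃,
x₄, …`, which yields the inverse; one spare variable, available when `n ≥ 5`, yields tameness. In
rank one all components are proportional over `K`. -/

namespace PolyMap

/-! ### Polynomials of low degree: derivatives, Wronskians and homogeneous factors. -/

section Degree

variable {K : Type*} [Field K] {n : ℕ}

theorem natCast_ne_zero_of_le_four (h6 : (6 : K) ≠ 0) {m : ℕ} (h0 : m ≠ 0) (h4 : m ≤ 4) :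
    (m : K) ≠ 0 := by
  have h2 : (2 : K) ≠ 0 := fun h => h6 (by linear_combination 3 * h)
  have h3 : (3 : K) ≠ 0 := fun h => h6 (by linear_combination 2 * h)
  interval_cases m
  · exact absurd rfl h0
  · simp
  · exact_mod_cast h2
  · exact_mod_cast h3
  · have : (4 : K) = 2 * 2 := by norm_num
    push_cast
    rw [this]
    exact mul_ne_zero h2 h2

theorem coeff_pderiv_sub_single {u : MvPolynomial (Fin n) K} {k : Fin n} {m : Fin n →₀ ℕ}
    (hk : m k ≠ 0) :
    coeff (m - Finsupp.single k 1) (pderiv k u) = coeff m u * (m k : K) := by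
  have h : m - Finsupp.single k 1 + Finsupp.single k 1 = m := by
    ext i
    by_cases hi : i = k
    · subst hi; simp; omega
    · simp [Ne.symm hi]
  rw [coeff_pderiv, h]
  have h' : (((m k - 1 : ℕ) : K)) + 1 = (m k : K) := by
    rw [← Nat.cast_succ]; congr 1; omega
  simp [h']

/-- In positive characteristic a zero derivative only constrains exponents modulo the
characteristic. The degree bound keeps every exponent at most 4, hence invertible in `K` when
nonzero. -/
theorem mem_supported_of_pderiv_eq_zero (h6 : (6 : K) ≠ 0) {u : MvPolynomial (Fin n) K}
    (hu : u.totalDegree ≤ 4) {s : Set (Fin n)} (h : ∀ k ∉ s, pderiv k u = 0) :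
    u ∈ supported K s := by
  rw [mem_supported]
  intro k hk
  by_contra hks
  obtain ⟨m, hm, hmk⟩ := (mem_vars_iff_mem_support k).1 hk
  have hmk' : m k ≠ 0 := by simpa using hmk
  have h1 := coeff_pderiv_sub_single (u := u) hmk'
  rw [h k hks, coeff_zero] at h1
  have h2 : m k ≤ 4 := by
    refine le_trans ?_ ((le_totalDegree hm).trans hu)
    rw [Finsupp.sum]
    exact Finset.single_le_sum (f := fun i => m i) (fun _ _ => Nat.zero_le _) hmk
  exact mul_ne_zero (mem_support_iff.1 hm) (natCast_ne_zero_of_le_four h6 hmk' h2) h1.symm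

theorem eq_C_of_pderiv_eq_zero (h6 : (6 : K) ≠ 0) {u : MvPolynomial (Fin n) K}
    (hu : u.totalDegree ≤ 4) (h : ∀ k, pderiv k u = 0) : ∃ a, u = C a := by
  have := mem_supported_of_pderiv_eq_zero h6 hu (s := ∅) fun k _ => h k
  rw [supported_empty, Algebra.mem_bot] at this
  obtain ⟨a, ha⟩ := this
  exact ⟨a, ha.symm⟩

theorem totalDegree_pderiv_le (u : MvPolynomial (Fin n) K) (k : Fin n) :
    (pderiv k u).totalDegree ≤ u.totalDegree - 1 := by
  refine Finset.sup_le fun m hm => ?_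
  have h : m + Finsupp.single k 1 ∈ u.support := by
    rw [mem_support_iff, coeff_pderiv] at hm
    exact mem_support_iff.2 (left_ne_zero_of_mul hm)
  have h1 := le_totalDegree h
  rw [Finsupp.sum_add_index' (by simp) (by simp)] at h1
  simp at h1
  omega

/-- The directional derivative along `v`. -/
noncomputable def dirDeriv (v : Fin n → K) :
    Derivation K (MvPolynomial (Fin n) K) (MvPolynomial (Fin n) K) :=
  ∑ k, v k • pderiv k

theorem dirDeriv_apply (v : Fin n → K) (u : MvPolynomial (Fin n) K) :
    dirDeriv v u = ∑ k, C (v k) * pderiv k u := by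
  have h := congrFun (map_sum (Derivation.coeFnAddMonoidHom (R := K)
    (A := MvPolynomial (Fin n) K) (M := MvPolynomial (Fin n) K)) (fun k => v k • pderiv k)
    Finset.univ) u
  simp only [Derivation.coeFnAddMonoidHom, AddMonoidHom.coe_mk, ZeroHom.coe_mk,
    Finset.sum_apply, Derivation.smul_apply, smul_eq_C_mul] at h
  exact h

theorem dirDeriv_single (k : Fin n) (u : MvPolynomial (Fin n) K) :
    dirDeriv (Pi.single k 1) u = pderiv k u := by
  rw [dirDeriv_apply, Finset.sum_eq_single k]
  · simp
  · intro b _ hb; simp [hb]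
  · simp

theorem dirDeriv_add (v w : Fin n → K) (u : MvPolynomial (Fin n) K) :
    dirDeriv (v + w) u = dirDeriv v u + dirDeriv w u := by
  simp [dirDeriv_apply, add_mul, Finset.sum_add_distrib]

theorem dirDeriv_smul (a : K) (v : Fin n → K) (u : MvPolynomial (Fin n) K) :
    dirDeriv (a • v) u = C a * dirDeriv v u := by
  simp [dirDeriv_apply, mul_assoc, Finset.mul_sum]

theorem totalDegree_dirDeriv_le (v : Fin n → K) (u : MvPolynomial (Fin n) K) :
    (dirDeriv v u).totalDegree ≤ u.totalDegree - 1 := by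
  rw [dirDeriv_apply]
  refine totalDegree_finsetSum_le fun k _ => ?_
  refine (totalDegree_mul _ _).trans ?_
  simpa using totalDegree_pderiv_le u k

/-- Differentiation along a constant direction lowers the degree, so a nonzero multiple of a
nonconstant `u` cannot arise this way. -/
theorem dirDeriv_eq_zero_of_dvd {v : Fin n → K} {u : MvPolynomial (Fin n) K}
    (h : u ∣ dirDeriv v u) : dirDeriv v u = 0 := by
  by_contra h0
  obtain ⟨q, hq⟩ := h
  have hu : u ≠ 0 := by rintro rfl; simp at h0
  have hq0 : q ≠ 0 := by rintro rfl; simp [hq] at h0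
  have h1 := totalDegree_dirDeriv_le v u
  have h2 := congrArg totalDegree hq
  rw [totalDegree_mul_of_isDomain hu hq0] at h2
  have h3 : u.totalDegree = 0 := by omega
  rw [totalDegree_eq_zero_iff_eq_C] at h3
  rw [h3] at h0
  exact h0 (by rw [dirDeriv_apply]; simp)

theorem pderiv_eq_zero_of_dvd {k : Fin n} {u : MvPolynomial (Fin n) K}
    (h : u ∣ pderiv k u) : pderiv k u = 0 := by
  rw [← dirDeriv_single] at h ⊢
  exact dirDeriv_eq_zero_of_dvd h

/-- Two polynomials of low degree with vanishing logarithmic Wronskians are proportional. -/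
theorem eq_C_mul_of_wronskian_eq_zero (h6 : (6 : K) ≠ 0) {f g : MvPolynomial (Fin n) K}
    (hf : f.totalDegree ≤ 4) (hg : g.totalDegree ≤ 4) (hg0 : g ≠ 0)
    (h : ∀ k, f * pderiv k g = g * pderiv k f) : ∃ a, f = C a * g := by
  by_cases hf0 : f = 0
  · exact ⟨0, by simp [hf0]⟩
  obtain ⟨g', f', c, hrel, hg', hf'⟩ := UniqueFactorizationMonoid.exists_reduced_factors g hg0 f
  have hc : c ≠ 0 := by rintro rfl; simp at hg'; exact hg0 hg'.symm
  have hf'0 : f' ≠ 0 := by rintro rfl; simp at hf'; exact hf0 hf'.symm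
  have hg'0 : g' ≠ 0 := by rintro rfl; simp at hg'; exact hg0 hg'.symm
  -- The common factor drops out of the Wronskian. Coprimality then makes `f'` and `g'` divide their
  -- own derivatives, so both are constants.
  have key : ∀ k, f' * pderiv k g' = g' * pderiv k f' := by
    intro k
    have := h k
    rw [← hf', ← hg'] at this
    simp only [pderiv_mul] at this
    refine mul_left_cancel₀ (mul_ne_zero hc hc) ?_
    linear_combination this
  have hdf : f'.totalDegree ≤ 4 := by
    have := congrArg totalDegree hf'
    rw [totalDegree_mul_of_isDomain hc hf'0] at this; omega
  have hdg : g'.totalDegree ≤ 4 := by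
    have := congrArg totalDegree hg'
    rw [totalDegree_mul_of_isDomain hc hg'0] at this; omega
  obtain ⟨a, ha⟩ := eq_C_of_pderiv_eq_zero h6 hdf fun k => pderiv_eq_zero_of_dvd
    (hrel.symm.dvd_of_dvd_mul_left (Dvd.intro _ (key k)))
  obtain ⟨b, hb⟩ := eq_C_of_pderiv_eq_zero h6 hdg fun k => pderiv_eq_zero_of_dvd
    (hrel.dvd_of_dvd_mul_left (Dvd.intro _ (key k).symm))
  have hb0 : b ≠ 0 := by rintro rfl; simp at hb; exact hg'0 hb
  refine ⟨a / b, ?_⟩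
  rw [← hf', ← hg', ha, hb]
  have : (C a : MvPolynomial (Fin n) K) = C (a / b) * C b := by
    rw [← C_mul, div_mul_cancel₀ _ hb0]
  rw [this]; ring

/-- A factor of a nonzero homogeneous polynomial is homogeneous. -/
theorem isHomogeneous_of_mul {f g : MvPolynomial (Fin n) K} {d : ℕ}
    (h : (f * g).IsHomogeneous d) (h0 : f * g ≠ 0) : f.IsHomogeneous f.totalDegree := by
  have hf0 := left_ne_zero_of_mul h0
  have hg0 := right_ne_zero_of_mul h0
  -- Scaling every variable by a new variable `T` records the grading as powers of `T`. Since the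
  -- product is a single power of `T`, top and bottom degrees coincide in each factor.
  let φ : MvPolynomial (Fin n) K →ₐ[K] Polynomial (MvPolynomial (Fin n) K) :=
    aeval fun i => Polynomial.C (X i) * Polynomial.X
  have hmon : ∀ (m : Fin n →₀ ℕ) (a : K), φ (monomial m a) =
      Polynomial.monomial m.degree (monomial m a) := by
    intro m a
    rw [aeval_monomial, Finsupp.prod_fintype _ _ (by simp), ← Polynomial.C_mul_X_pow_eq_monomial,
      Finsupp.degree_eq_sum, monomial_eq, Finsupp.prod_fintype _ _ (by simp)]
    simp only [map_mul, map_prod, map_pow, mul_pow, Finset.prod_mul_distrib,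
      Finset.prod_pow_eq_pow_sum]
    rw [← mul_assoc]
    rfl
  have hφ : ∀ u : MvPolynomial (Fin n) K, ∀ k, (φ u).coeff k = homogeneousComponent k u := by
    intro u k
    induction u using MvPolynomial.induction_on' with
    | add p q hp hq => simp [hp, hq]
    | monomial m a =>
      rw [hmon, Polynomial.coeff_monomial]
      split_ifs with hmk
      · rw [homogeneousComponent_of_mem (isHomogeneous_monomial a hmk), if_pos rfl]
      · rw [homogeneousComponent_of_mem (isHomogeneous_monomial a rfl), if_neg (Ne.symm hmk)]
  have hinj : ∀ u, u ≠ 0 → φ u ≠ 0 := by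
    intro u hu h'
    apply hu
    rw [← sum_homogeneousComponent u]
    exact Finset.sum_eq_zero fun k _ => by rw [← hφ, h', Polynomial.coeff_zero]
  have hfg : φ f * φ g = Polynomial.monomial d (f * g) := by
    rw [← map_mul]
    ext1 k
    rw [hφ, Polynomial.coeff_monomial, homogeneousComponent_of_mem h]
    split_ifs with h1 h2 h2 <;> first | rfl | (exfalso; omega)
  have h1 := Polynomial.natDegree_mul (hinj f hf0) (hinj g hg0)
  have h2 := Polynomial.natTrailingDegree_mul (hinj f hf0) (hinj g hg0)
  rw [hfg, Polynomial.natDegree_monomial_eq _ h0] at h1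
  rw [hfg, Polynomial.natTrailingDegree_monomial h0] at h2
  have h3 := Polynomial.natTrailingDegree_le_natDegree (φ f)
  have h4 := Polynomial.natTrailingDegree_le_natDegree (φ g)
  have h5 : f.IsHomogeneous (φ f).natDegree := by
    have hs : f = homogeneousComponent (φ f).natDegree f := by
      conv_lhs => rw [← sum_homogeneousComponent f]
      by_cases hr : (φ f).natDegree ∈ Finset.range (f.totalDegree + 1)
      · refine Finset.sum_eq_single_of_mem _ hr fun k _ hk => ?_
        rw [← hφ]
        rcases lt_or_gt_of_ne hk with hlt | hgt
        · exact Polynomial.coeff_eq_zero_of_lt_natTrailingDegree (by omega)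
        · exact Polynomial.coeff_eq_zero_of_natDegree_lt hgt
      · exfalso
        have := homogeneousComponent_eq_zero (φ f).natDegree f (by simpa using hr)
        rw [← hφ] at this
        exact hinj f hf0 (Polynomial.leadingCoeff_eq_zero.1 this)
    have := homogeneousComponent_isHomogeneous (φ f).natDegree f
    rwa [← hs] at this
  rwa [h5.totalDegree hf0]

theorem exists_eq_sum_of_isHomogeneous_one {u : MvPolynomial (Fin n) K}
    (hu : u.IsHomogeneous 1) :
    ∃ a : Fin n → K, u = ∑ k, C (a k) * X k ∧ ∀ k, pderiv k u = C (a k) := by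
  have h : ∀ k, ∃ a, pderiv k u = C a := fun k =>
    ⟨_, totalDegree_eq_zero_iff_eq_C.1 ((totalDegree_zero_iff_isHomogeneous _).2 (hu.pderiv (i := k)))⟩
  choose a ha using h
  refine ⟨a, ?_, ha⟩
  have := hu.sum_X_mul_pderiv
  simp only [ha, one_smul] at this
  rw [← this]
  exact Finset.sum_congr rfl fun k _ => mul_comm _ _

end Degree

end PolyMap

namespace PolyMap

/-! ### Invertible matrices with prescribed columns. -/

section Basis

variable {K : Type*} [Field K] {n : ℕ}

/-- A linearly independent family can be extended by vectors of a subspace `N` to the columns of an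
invertible matrix, as soon as it spans the whole space together with `N`. -/
theorem exists_GL_extending {k : ℕ} (u : Fin k → Fin n → K) (hu : LinearIndependent K u)
    (N : Submodule K (Fin n → K)) (hN : Submodule.span K (Set.range u) ⊔ N = ⊤) :
    ∃ (hk : k ≤ n) (T : Matrix.GeneralLinearGroup (Fin n) K),
      (∀ i : Fin k, (fun a => T.1 a (Fin.castLE hk i)) = u i) ∧
      ∀ j : Fin n, k ≤ j.val → (fun a => T.1 a j) ∈ N := by
  classical
  have hli : LinearIndepOn K id (Set.range u) := hu.linearIndepOn_id
  have hst : Set.range u ⊆ Set.range u ∪ (N : Set (Fin n → K)) := Set.subset_union_left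
  have ht : ⊤ ≤ Submodule.span K (Set.range u ∪ (N : Set (Fin n → K))) := by
    rw [Submodule.span_union, Submodule.span_eq, hN]
  let b := Module.Basis.extendLe hli hst ht
  have hsub : Set.range u ⊆ hli.extend hst := hli.subset_extend hst
  have : Finite (hli.extend hst) := Module.Finite.finite_basis b
  have := Fintype.ofFinite (hli.extend hst)
  have hcard : Fintype.card (hli.extend hst) = n := by
    rw [← Module.finrank_eq_card_basis b]; simp
  let f : Fin k → hli.extend hst := fun i => ⟨u i, hsub ⟨i, rfl⟩⟩
  have hf : Function.Injective f := fun i j hij => hu.injective (congrArg Subtype.val hij)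
  have hk : k ≤ n := by
    simpa [hcard] using Fintype.card_le_of_injective f hf
  obtain ⟨e, he⟩ : ∃ e : Fin n ≃ hli.extend hst, ∀ i, e (Fin.castLE hk i) = f i := by
    let e₀ : Fin n ≃ hli.extend hst := Fintype.equivOfCardEq (by simp [hcard])
    obtain ⟨σ, hσ⟩ := Equiv.Perm.exists_extending_pair (Fin.castLE hk) (fun i => e₀.symm (f i))
      (Fin.castLE_injective hk) (e₀.symm.injective.comp hf)
    exact ⟨σ.trans e₀, fun i => by simp [hσ i]⟩
  let b' := b.reindex e.symm
  have hb' : ∀ j, b' j = (e j : Fin n → K) := fun j => by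
    simp [b', b]
  let M : Matrix (Fin n) (Fin n) K := (Pi.basisFun K (Fin n)).toMatrix b'
  have hM : IsUnit M := by
    refine ⟨⟨M, b'.toMatrix (Pi.basisFun K (Fin n)), ?_, ?_⟩, rfl⟩ <;>
      simp [M]
  obtain ⟨T, hT⟩ := hM
  have hcol : ∀ j, (fun a => T.1 a j) = (e j : Fin n → K) := fun j => by
    ext a
    rw [show T.1 = M from hT, ← hb']
    simp [M, Module.Basis.toMatrix_apply]
  refine ⟨hk, T, fun i => ?_, fun j hj => ?_⟩
  · rw [hcol, he]
  · rw [hcol]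
    rcases hli.extend_subset hst (e j).2 with ⟨i, hi⟩ | h
    · exfalso
      have : e j = e (Fin.castLE hk i) := by rw [he]; exact Subtype.ext hi.symm
      rw [e.injective this] at hj
      simp at hj
      omega
    · exact h

/-- A subspace of codimension at most `k` contains all but the first `k` columns of some
invertible matrix. -/
theorem exists_GL_col_mem (k : ℕ) (N : Submodule K (Fin n → K))
    (hN : n ≤ Module.finrank K N + k) :
    ∃ T : Matrix.GeneralLinearGroup (Fin n) K,
      ∀ j : Fin n, k ≤ j.val → (fun a => T.1 a j) ∈ N := by
  obtain ⟨N', hN'⟩ := N.exists_isCompl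
  have h := Submodule.finrank_add_eq_of_isCompl hN'
  rw [Module.finrank_fin_fun] at h
  let b := Module.finBasis K N'
  obtain ⟨hk, T, -, hT⟩ := exists_GL_extending (fun i => (b i : Fin n → K))
    (b.linearIndependent.map' N'.subtype (Submodule.ker_subtype _)) N (by
      have : Submodule.span K (Set.range fun i => (b i : Fin n → K)) = N' := by
        have h1 : (Set.range fun i => (b i : Fin n → K)) = N'.subtype '' Set.range b := by
          rw [← Set.range_comp]; rfl
        rw [h1, Submodule.span_image, b.span_eq, Submodule.map_top, Submodule.range_subtype]
      rw [this, sup_comm]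
      exact hN'.sup_eq_top)
  exact ⟨T, fun j hj => hT j (by omega)⟩

end Basis

end PolyMap

namespace PolyMap

/-! ### Linear conjugation, its effect on the Jacobian, and trace conditions. -/

section Conj

variable {K : Type*} [Field K] {n : ℕ}

theorem comp_assoc (F G H : PolyMap n K) : (F.comp G).comp H = F.comp (G.comp H) := by
  funext i
  simp only [comp, bind₁_bind₁]
  rfl

theorem comp_X (F : PolyMap n K) : F.comp X = F := by
  funext i
  simp [comp]

theorem X_comp (F : PolyMap n K) : comp X F = F := by
  funext i
  simp [comp]

theorem linear_comp_linear (A B : Matrix (Fin n) (Fin n) K) :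
    (linear A).comp (linear B) = linear (A * B) := by
  funext i
  simp only [comp, linear, map_sum, map_mul, bind₁_C_right, bind₁_X_right, Finset.mul_sum,
    Matrix.mul_apply, Finset.sum_mul]
  rw [Finset.sum_comm]
  exact Finset.sum_congr rfl fun _ _ => Finset.sum_congr rfl fun _ _ => by ring

theorem linear_one : linear (1 : Matrix (Fin n) (Fin n) K) = X := by
  funext i
  simp [linear, Matrix.one_apply]

theorem linear_mul_inv (T : Matrix.GeneralLinearGroup (Fin n) K) :
    (linear T.1).comp (linear (T⁻¹).1) = X := by
  rw [linear_comp_linear, ← Units.val_mul, mul_inv_cancel, Units.val_one, linear_one]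

theorem linear_inv_mul (T : Matrix.GeneralLinearGroup (Fin n) K) :
    (linear (T⁻¹).1).comp (linear T.1) = X := by
  rw [linear_comp_linear, ← Units.val_mul, inv_mul_cancel, Units.val_one, linear_one]

theorem conj_conj (S T : Matrix.GeneralLinearGroup (Fin n) K) (H : PolyMap n K) :
    conj S (conj T H) = conj (T * S) H := by
  simp only [conj, mul_inv_rev, Units.val_mul, ← linear_comp_linear, comp_assoc]

theorem conj_one (H : PolyMap n K) : conj 1 H = H := by
  simp only [conj, inv_one, Units.val_one, linear_one, comp_X, X_comp]

theorem conj_apply (T : Matrix.GeneralLinearGroup (Fin n) K) (H : PolyMap n K) (i : Fin n) :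
    conj T H i = ∑ k, C ((T⁻¹).1 i k) * bind₁ (linear T.1) (H k) := by
  simp [conj, comp, linear]

theorem pderiv_bind₁_linear (A : Matrix (Fin n) (Fin n) K) (j : Fin n)
    (u : MvPolynomial (Fin n) K) :
    pderiv j (bind₁ (linear A) u) = bind₁ (linear A) (dirDeriv (fun l => A l j) u) := by
  induction u using MvPolynomial.induction_on with
  | C a => simp
  | add p q hp hq => simp [hp, hq]
  | mul_X p i hp =>
    rw [Derivation.leibniz, map_mul, Derivation.leibniz, hp, bind₁_X_right, map_add]
    simp only [smul_eq_mul, map_mul, bind₁_X_right]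
    congr 2
    simp [dirDeriv_apply, linear, Pi.single_apply]

theorem pderiv_conj (T : Matrix.GeneralLinearGroup (Fin n) K) (H : PolyMap n K) (i j : Fin n) :
    pderiv j (conj T H i) =
      ∑ k, C ((T⁻¹).1 i k) * bind₁ (linear T.1) (dirDeriv (fun l => T.1 l j) (H k)) := by
  rw [conj_apply, map_sum]
  simp only [pderiv_C_mul, pderiv_bind₁_linear]

theorem bind₁_linear_injective (T : Matrix.GeneralLinearGroup (Fin n) K) :
    Function.Injective (bind₁ (linear T.1)) := by
  intro u v h
  have := congrArg (bind₁ (linear (T⁻¹).1)) h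
  rw [bind₁_bind₁, bind₁_bind₁] at this
  have h' : (fun i => bind₁ (linear (T⁻¹).1) (linear T.1 i)) = X := linear_mul_inv T
  rwa [h', ← aeval_eq_bind₁, aeval_X_left, AlgHom.id_apply, AlgHom.id_apply] at this

theorem jacobian_conj (T : Matrix.GeneralLinearGroup (Fin n) K) (H : PolyMap n K) :
    (conj T H).jacobian =
      ((T⁻¹).1.map C * H.jacobian * T.1.map C).map (bind₁ (linear T.1)) := by
  ext1 i j
  simp only [jacobian, Matrix.of_apply, pderiv_conj, Matrix.map_apply, Matrix.mul_apply,
    dirDeriv_apply, map_sum, map_mul, bind₁_C_right, Finset.mul_sum, Finset.sum_mul]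
  rw [Finset.sum_comm]
  exact Finset.sum_congr rfl fun _ _ => Finset.sum_congr rfl fun _ _ => by ring

theorem isHomogeneous_conj {d : ℕ} (T : Matrix.GeneralLinearGroup (Fin n) K) {H : PolyMap n K}
    (hH : ∀ i, (H i).IsHomogeneous d) (i : Fin n) : (conj T H i).IsHomogeneous d := by
  rw [conj_apply]
  refine IsHomogeneous.sum _ _ _ fun k _ => IsHomogeneous.C_mul ?_ _
  have := (hH k).aeval (linear T.1) (n := 1) fun i =>
    IsHomogeneous.sum _ _ _ fun j _ => (isHomogeneous_X K j).C_mul _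
  simpa using this

theorem isNilpotent_jacobian_conj (T : Matrix.GeneralLinearGroup (Fin n) K) {H : PolyMap n K}
    (hH : IsNilpotent H.jacobian) : IsNilpotent (conj T H).jacobian := by
  rw [jacobian_conj]
  obtain ⟨m, hm⟩ := hH
  have h1 : (T.1.map C : Matrix (Fin n) (Fin n) (MvPolynomial (Fin n) K)) *
      (T⁻¹).1.map C = 1 := by
    rw [← Matrix.map_mul, ← Units.val_mul, mul_inv_cancel, Units.val_one]
    exact Matrix.map_one _ (map_zero _) (map_one _)
  have h2 : ∀ m, ((T⁻¹).1.map C * H.jacobian * T.1.map C) ^ (m + 1) =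
      (T⁻¹).1.map C * H.jacobian ^ (m + 1) * T.1.map C := by
    intro m
    induction m with
    | zero => simp
    | succ m ih =>
      rw [pow_succ, ih, pow_succ H.jacobian (m + 1)]
      simp only [mul_assoc]
      rw [← mul_assoc (T.1.map C) ((T⁻¹).1.map C), h1, one_mul]
  have h3 : IsNilpotent ((T⁻¹).1.map C * H.jacobian * T.1.map C) :=
    ⟨m + 1, by rw [h2, pow_succ, hm]; simp⟩
  exact h3.map (RingHom.mapMatrix (bind₁ (linear T.1)).toRingHom)

theorem similarToTriangular_iff (H : PolyMap n K) :
    SimilarToTriangular H.jacobian ↔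
      ∃ T : Matrix.GeneralLinearGroup (Fin n) K, IsTriangular (conj T H).jacobian := by
  refine exists_congr fun T => ?_
  rw [jacobian_conj]
  simp only [IsTriangular, Matrix.map_apply, map_eq_zero_iff _ (bind₁_linear_injective T)]

theorem similarToTriangular_of_conj (T : Matrix.GeneralLinearGroup (Fin n) K) {H : PolyMap n K}
    (h : SimilarToTriangular (conj T H).jacobian) : SimilarToTriangular H.jacobian := by
  rw [similarToTriangular_iff] at h ⊢
  obtain ⟨S, hS⟩ := h
  exact ⟨T * S, by rwa [← conj_conj]⟩

/-- The permutation matrix of `σ`, as an element of the general linear group. -/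
def permGL (σ : Equiv.Perm (Fin n)) : Matrix.GeneralLinearGroup (Fin n) K where
  val := Matrix.of fun i j => if i = σ j then 1 else 0
  inv := Matrix.of fun i j => if σ i = j then 1 else 0
  val_inv := by
    ext i j
    simp only [Matrix.mul_apply, Matrix.of_apply, mul_ite, mul_one, mul_zero, Matrix.one_apply]
    rw [Finset.sum_eq_single (σ.symm j)]
    · simp
    · intro b _ hb
      rw [if_neg]
      rintro rfl
      simp at hb
    · simp
  inv_val := by
    ext i j
    simp [Matrix.mul_apply, Matrix.one_apply]

theorem conj_permGL (σ : Equiv.Perm (Fin n)) (H : PolyMap n K) (i : Fin n) :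
    conj (permGL σ) H i = bind₁ (linear (permGL (K := K) σ).1) (H (σ i)) := by
  rw [conj_apply]
  have : ∀ k, ((permGL (K := K) σ)⁻¹).1 i k = if σ i = k then 1 else 0 := fun k => rfl
  simp [this, apply_ite]

/-- Sorting the variables by increasing height puts all nonzero entries of the Jacobian strictly
below the diagonal. -/
theorem similarToTriangular_of_height {H : PolyMap n K} (ht : Fin n → ℕ)
    (h : ∀ i j, ht i ≤ ht j → pderiv j (H i) = 0) : SimilarToTriangular H.jacobian := by
  rw [similarToTriangular_iff]
  refine ⟨permGL (Tuple.sort ht), Or.inr fun i j hij => ?_⟩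
  rw [jacobian, Matrix.of_apply, conj_permGL, pderiv_bind₁_linear, dirDeriv_apply,
    Finset.sum_eq_single (Tuple.sort ht j)]
  · rw [h _ _ (Tuple.monotone_sort ht hij.le)]
    simp
  · intro b _ hb
    simp [permGL, hb]
  · simp

theorem trace_eq_zero {H : PolyMap n K} (hH : IsNilpotent H.jacobian) :
    ∑ i, pderiv i (H i) = 0 :=
  (Matrix.isNilpotent_trace_of_isNilpotent hH).eq_zero

theorem trace_sq_eq_zero {H : PolyMap n K} (hH : IsNilpotent H.jacobian) :
    ∑ i, ∑ j, pderiv j (H i) * pderiv i (H j) = 0 := by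
  have : IsNilpotent (H.jacobian * H.jacobian) := by
    rw [← sq]; exact hH.pow_of_pos two_ne_zero
  exact (Matrix.isNilpotent_trace_of_isNilpotent this).eq_zero

theorem exists_conj_eq_zero {H : PolyMap n K} {k : ℕ}
    (h : Module.finrank K (Submodule.span K (Set.range H)) ≤ k) :
    ∃ T : Matrix.GeneralLinearGroup (Fin n) K, ∀ i : Fin n, k ≤ i.val → conj T H i = 0 := by
  let φ := Fintype.linearCombination K H
  have h1 := LinearMap.finrank_range_add_finrank_ker φ
  rw [Fintype.range_linearCombination, Module.finrank_fin_fun] at h1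
  obtain ⟨T, hT⟩ := exists_GL_col_mem k (LinearMap.ker φ) (by omega)
  -- The kernel of `φ` consists of the linear relations among the components. As `S⁻¹` is the
  -- transpose of `T`, column `i` of `T` holds the coefficients of component `i` of the conjugate.
  let S : Matrix.GeneralLinearGroup (Fin n) K :=
    ⟨(T⁻¹).1.transpose, T.1.transpose,
      by rw [← Matrix.transpose_mul, ← Units.val_mul, mul_inv_cancel]; simp,
      by rw [← Matrix.transpose_mul, ← Units.val_mul, inv_mul_cancel]; simp⟩
  refine ⟨S, fun i hi => ?_⟩
  have h2 := hT i hi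
  rw [LinearMap.mem_ker, Fintype.linearCombination_apply] at h2
  rw [conj_apply]
  have h3 := congrArg (bind₁ (linear S.1)) h2
  simp only [map_sum, smul_eq_C_mul, map_mul, bind₁_C_right, map_zero] at h3
  exact h3

theorem X_add_conj (T : Matrix.GeneralLinearGroup (Fin n) K) (H : PolyMap n K) :
    (fun i => X i + conj T H i : PolyMap n K) =
      comp (comp (linear (T⁻¹).1) (fun i => X i + H i)) (linear T.1) := by
  have h := linear_inv_mul T
  funext i
  rw [← congrFun h i]
  simp [conj_apply, comp, linear, mul_add, Finset.sum_add_distrib]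

theorem X_add_eq_comp (T : Matrix.GeneralLinearGroup (Fin n) K) (H : PolyMap n K) :
    (fun i => X i + H i : PolyMap n K) =
      comp (comp (linear T.1) (fun i => X i + conj T H i)) (linear (T⁻¹).1) := by
  rw [X_add_conj]
  simp only [comp_assoc, linear_mul_inv, comp_X]
  rw [← comp_assoc, linear_mul_inv, X_comp]

end Conj

end PolyMap

namespace PolyMap

/-! ### Tame and invertible maps; the triangular case. -/

section Tame

variable {K : Type*} [Field K] {n : ℕ}

theorem bind₁_eq_self {G : PolyMap n K} {s : Set (Fin n)} (hG : ∀ j ∈ s, G j = X j)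
    {u : MvPolynomial (Fin n) K} (hu : u ∈ supported K s) : bind₁ G u = u := by
  have h : Set.EqOn (bind₁ G) (AlgHom.id K _) (X '' s) := by
    rintro _ ⟨j, hj, rfl⟩
    simp [hG j hj]
  exact AlgHom.eqOn_adjoin_iff.2 h hu

theorem linear_eq_affine (A : Matrix (Fin n) (Fin n) K) : linear A = affine A 0 := by
  funext i
  simp [linear, affine]

theorem isTame_linear (T : Matrix.GeneralLinearGroup (Fin n) K) : IsTame (linear T.1) := by
  rw [linear_eq_affine]
  exact IsTame.affine T 0

theorem isTame_X : IsTame (X : PolyMap n K) := by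
  have := isTame_linear (1 : Matrix.GeneralLinearGroup (Fin n) K)
  rwa [Units.val_one, linear_one] at this

theorem IsTame.update_add {F : PolyMap n K} (hF : IsTame F) (i : Fin n)
    {f : MvPolynomial (Fin n) K} (hf : f ∈ supported K {j | j ≠ i}) :
    IsTame (Function.update F i (F i + bind₁ F f)) := by
  have : Function.update F i (F i + bind₁ F f) = PolyMap.comp (Function.update X i (X i + f)) F := by
    funext j
    by_cases hj : j = i
    · subst hj; simp [PolyMap.comp]
    · simp [PolyMap.comp, hj]
  rw [this]
  exact IsTame.comp (IsTame.elementary i f hf) hF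

/-- The coordinates are modified in order of increasing height: `H a` involves only variables of
larger height, which are still untouched when `a` is treated. -/
theorem isTame_of_height {H : PolyMap n K} (ht : Fin n → ℕ)
    (h : ∀ i, H i ∈ supported K {j | ht i < ht j}) : IsTame (fun i => X i + H i : PolyMap n K) := by
  classical
  have key : ∀ s : Finset (Fin n), IsTame (fun i => if i ∈ s then X i + H i else X i) := by
    intro s
    induction s using Finset.induction_on_max_value ht with
    | empty => simpa using isTame_X
    | insert a s ha hs ih =>
      have hsub : {j | ht a < ht j} ⊆ {j | j ≠ a} := by
        rintro j hj rfl
        exact lt_irrefl _ (show ht j < ht j from hj)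
      have h1 : H a ∈ supported K {j | j ≠ a} := supported_mono hsub (h a)
      convert ih.update_add a h1 using 1
      funext i
      by_cases hi : i = a
      · subst hi
        rw [Function.update_self, bind₁_eq_self (s := {j | ht i < ht j}) _ (h i)]
        · simp [ha]
        · intro j hj
          rw [if_neg fun hjs => not_lt.2 (hs j hjs) hj]
      · simp [hi]
  simpa using key Finset.univ

theorem isTame_of_conj (T : Matrix.GeneralLinearGroup (Fin n) K) {H : PolyMap n K}
    (h : IsTame (fun i => X i + conj T H i)) : IsTame (fun i => X i + H i) := by
  rw [X_add_eq_comp T]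
  exact IsTame.comp (IsTame.comp (isTame_linear T) h) (isTame_linear T⁻¹)

theorem IsInvertible.comp {F G : PolyMap n K} (hF : IsInvertible F) (hG : IsInvertible G) :
    IsInvertible (comp F G) := by
  obtain ⟨F', h1, h2⟩ := hF
  obtain ⟨G', h3, h4⟩ := hG
  refine ⟨PolyMap.comp G' F', ?_, ?_⟩
  · rw [comp_assoc, ← comp_assoc G, h3, X_comp, h1]
  · rw [comp_assoc, ← comp_assoc F', h2, X_comp, h4]

theorem isInvertible_affine (T : Matrix.GeneralLinearGroup (Fin n) K) (b : Fin n → K) :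
    IsInvertible (affine T.1 b) := by
  have h0 : ∀ (T : Matrix.GeneralLinearGroup (Fin n) K) (b : Fin n → K),
      affine T.1 b = PolyMap.comp (fun i => X i + C (b i)) (linear T.1) := by
    intro T b
    funext i
    simp [affine, comp, linear]
  rw [h0]
  refine IsInvertible.comp ⟨fun i => X i - C (b i), ?_, ?_⟩
    ⟨_, linear_mul_inv T, linear_inv_mul T⟩ <;>
  · funext i
    simp [comp]

theorem isInvertible_elementary (i : Fin n) {f : MvPolynomial (Fin n) K}
    (hf : f ∈ supported K {j | j ≠ i}) : IsInvertible (Function.update X i (X i + f)) := by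
  have key : ∀ f ∈ supported K {j | j ≠ i},
      comp (Function.update X i (X i + f)) (Function.update X i (X i - f)) = X := by
    intro f hf
    funext j
    by_cases hj : j = i
    · subst hj
      have : bind₁ (Function.update X j (X j - f)) f = f :=
        bind₁_eq_self (s := {k | k ≠ j}) (fun k hk => by simp [show k ≠ j from hk]) hf
      simp [comp, this]
    · simp [comp, hj]
  refine ⟨Function.update X i (X i - f), key f hf, ?_⟩
  have := key (-f) (neg_mem hf)
  rwa [sub_neg_eq_add, ← sub_eq_add_neg] at this

theorem IsTame.isInvertible {F : PolyMap n K} (hF : IsTame F) : IsInvertible F := by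
  induction hF with
  | affine T b => exact isInvertible_affine T b
  | elementary i f hf => exact isInvertible_elementary i hf
  | comp _ _ hF hG => exact hF.comp hG

theorem isInvertible_of_conj (T : Matrix.GeneralLinearGroup (Fin n) K) {H : PolyMap n K}
    (h : IsInvertible (fun i => X i + conj T H i)) : IsInvertible (fun i => X i + H i) := by
  rw [X_add_eq_comp T]
  exact IsInvertible.comp (IsInvertible.comp (isTame_linear T).isInvertible h)
    (isTame_linear T⁻¹).isInvertible

/-- The characteristic polynomial is a power of the variable by nilpotency, and a product of linear
factors with the diagonal entries as roots by triangularity. -/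
theorem diag_eq_zero_of_isTriangular {R : Type*} [CommRing R] [IsDomain R]
    {M : Matrix (Fin n) (Fin n) R} (hM : IsNilpotent M) (ht : IsTriangular M) (i : Fin n) :
    M i i = 0 := by
  have h1 := (Matrix.isNilpotent_charpoly_sub_pow_of_isNilpotent hM).eq_zero
  rw [sub_eq_zero] at h1
  have h2 : M.charpoly = ∏ j, (Polynomial.X - Polynomial.C (M j j)) := by
    rcases ht with h | h
    · exact Matrix.charpoly_of_isUpperTriangular M fun i j hij => h i j hij
    · rw [← Matrix.charpoly_transpose]
      exact Matrix.charpoly_of_isUpperTriangular M.transpose fun i j hij => h j i hij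
  have h3 := congrArg (Polynomial.eval (M i i)) (h1.symm.trans h2)
  rw [Polynomial.eval_prod, Finset.prod_eq_zero (Finset.mem_univ i) (by simp)] at h3
  simp only [Polynomial.eval_pow, Polynomial.eval_X] at h3
  exact eq_zero_of_pow_eq_zero h3

theorem isTame_of_similarToTriangular (h6 : (6 : K) ≠ 0) {H : PolyMap n K}
    (hH : ∀ i, (H i).IsHomogeneous 3) (hnil : IsNilpotent H.jacobian)
    (h : SimilarToTriangular H.jacobian) : IsTame (fun i => X i + H i : PolyMap n K) := by
  obtain ⟨T, hT⟩ := (similarToTriangular_iff H).1 h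
  refine isTame_of_conj T ?_
  have hd := diag_eq_zero_of_isTriangular (isNilpotent_jacobian_conj T hnil) hT
  have hdeg : ∀ i, (conj T H i).totalDegree ≤ 4 := fun i =>
    (isHomogeneous_conj T hH i).totalDegree_le.trans (by norm_num)
  rcases hT with h | h
  · refine isTame_of_height (fun i => i.val) fun i =>
      mem_supported_of_pderiv_eq_zero h6 (hdeg i) fun k hk => ?_
    rcases eq_or_ne k i with rfl | hki
    · exact hd k
    · exact h i k (lt_of_le_of_ne (Fin.le_def.2 (not_lt.1 hk)) hki)
  -- In the lower triangular case components involve only earlier variables, so the height must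
  -- decrease with the index; the truncated subtraction is exact because `i.val < n`.
  · refine isTame_of_height (fun i => n - i.val) fun i =>
      mem_supported_of_pderiv_eq_zero h6 (hdeg i) fun k hk => ?_
    rcases eq_or_ne k i with rfl | hki
    · exact hd k
    · refine h i k ?_
      have h1 : ¬ (n - i.val < n - k.val) := hk
      have h2 : k.val ≠ i.val := fun h => hki (Fin.ext h)
      rw [Fin.lt_def]
      omega

/-! ### Invertibility and stable tameness of the normal form. -/

section NormalForm

variable {i₀ i₁ i₂ i₃ : Fin n} {f g : MvPolynomial (Fin n) K} {H : PolyMap n K}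

/-- Apart from `f` and `g`, the map adds `x₄w` to `x₁` and `x₃w` to `x₂`, where `w = x₁x₃ - x₂x₄`.
This leaves `w` unchanged, so `w` can be recovered from the image once `f` and `g` are removed, and
then subtracted. -/
theorem isInvertible_normalForm (h01 : i₀ ≠ i₁) (h02 : i₀ ≠ i₂) (h03 : i₀ ≠ i₃) (h12 : i₁ ≠ i₂)
    (h13 : i₁ ≠ i₃) (hf : f ∈ supported K {j | j ≠ i₀ ∧ j ≠ i₁})
    (hg : g ∈ supported K {j | j ≠ i₀ ∧ j ≠ i₁})
    (H0 : H i₀ = X i₀ * X i₂ * X i₃ - X i₁ * X i₃ ^ 2 + f)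
    (H1 : H i₁ = X i₀ * X i₂ ^ 2 - X i₁ * X i₂ * X i₃ + g)
    (H2 : ∀ i, i ≠ i₀ → i ≠ i₁ → H i = 0) : IsInvertible (fun i => X i + H i) := by
  classical
  let w : MvPolynomial (Fin n) K := (X i₀ - f) * X i₂ - (X i₁ - g) * X i₃
  let G : PolyMap n K := Function.update (Function.update X i₀ (X i₀ - f - X i₃ * w)) i₁
    (X i₁ - g - X i₂ * w)
  have G0 : G i₀ = X i₀ - f - X i₃ * w := by simp [G, h01]
  have G1 : G i₁ = X i₁ - g - X i₂ * w := by simp [G]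
  have GX : ∀ i, i ≠ i₀ → i ≠ i₁ → G i = X i := fun i hi hi' => by simp [G, hi, hi']
  have G2 := GX i₂ h02.symm h12.symm
  have G3 := GX i₃ h03.symm h13.symm
  have Gf := bind₁_eq_self (G := G) (fun j hj => GX j hj.1 hj.2) hf
  have Gg := bind₁_eq_self (G := G) (fun j hj => GX j hj.1 hj.2) hg
  have FX : ∀ i, i ≠ i₀ → i ≠ i₁ → X i + H i = X i := fun i hi hi' => by
    rw [H2 i hi hi', add_zero]
  have F2 := FX i₂ h02.symm h12.symm
  have F3 := FX i₃ h03.symm h13.symm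
  have Ff := bind₁_eq_self (G := fun i => X i + H i) (fun j hj => FX j hj.1 hj.2) hf
  have Fg := bind₁_eq_self (G := fun i => X i + H i) (fun j hj => FX j hj.1 hj.2) hg
  refine ⟨G, ?_, ?_⟩
  · funext i
    simp only [comp]
    rcases eq_or_ne i i₀ with rfl | hi0
    · simp only [H0, map_add, map_sub, map_mul, map_pow, bind₁_X_right, G0, G1, G2, G3, Gf]
      ring
    · rcases eq_or_ne i i₁ with rfl | hi1
      · simp only [H1, map_add, map_sub, map_mul, map_pow, bind₁_X_right, G0, G1, G2, G3, Gg]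
        ring
      · rw [FX i hi0 hi1, bind₁_X_right, GX i hi0 hi1]
  · funext i
    simp only [comp]
    rcases eq_or_ne i i₀ with rfl | hi0
    · simp only [G0, w, map_sub, map_mul, bind₁_X_right, F2, F3, Ff, Fg, H0, H1]
      ring
    · rcases eq_or_ne i i₁ with rfl | hi1
      · simp only [G1, w, map_sub, map_mul, bind₁_X_right, F2, F3, Ff, Fg, H0, H1]
        ring
      · rw [GX i hi0 hi1, bind₁_X_right, FX i hi0 hi1]

/-- With `w = x₁x₃ - x₂x₄`, the essential part is a commutator: add `w` to the spare variable `t`,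
add `x₄t` and `x₃t` to `x₁` and `x₂`, then undo both. Since `w` is preserved by the second
operation, the terms in `t` cancel and `x₄w`, `x₃w` remain. -/
theorem isTame_normalForm {t : Fin n} (h01 : i₀ ≠ i₁) (h02 : i₀ ≠ i₂) (h03 : i₀ ≠ i₃)
    (h12 : i₁ ≠ i₂) (h13 : i₁ ≠ i₃) (h0t : i₀ ≠ t) (h1t : i₁ ≠ t) (h2t : i₂ ≠ t) (h3t : i₃ ≠ t)
    (hf : f ∈ supported K {j | j ≠ i₀ ∧ j ≠ i₁})
    (hg : g ∈ supported K {j | j ≠ i₀ ∧ j ≠ i₁})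
    (H0 : H i₀ = X i₀ * X i₂ * X i₃ - X i₁ * X i₃ ^ 2 + f)
    (H1 : H i₁ = X i₀ * X i₂ ^ 2 - X i₁ * X i₂ * X i₃ + g)
    (H2 : ∀ i, i ≠ i₀ → i ≠ i₁ → H i = 0) : IsTame (fun i => X i + H i) := by
  classical
  have hX : ∀ {i j : Fin n}, i ≠ j → (X i : MvPolynomial (Fin n) K) ∈ supported K {k | k ≠ j} :=
    fun h => X_mem_supported.2 h
  have hw : (X i₀ * X i₂ - X i₁ * X i₃ : MvPolynomial (Fin n) K) ∈ supported K {k | k ≠ t} :=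
    sub_mem (mul_mem (hX h0t) (hX h2t)) (mul_mem (hX h1t) (hX h3t))
  have a0 : (X i₃ * X t : MvPolynomial (Fin n) K) ∈ supported K {k | k ≠ i₀} :=
    mul_mem (hX h03.symm) (hX h0t.symm)
  have a1 : (X i₂ * X t : MvPolynomial (Fin n) K) ∈ supported K {k | k ≠ i₁} :=
    mul_mem (hX h12.symm) (hX h1t.symm)
  have hf0 : f ∈ supported K {k | k ≠ i₀} := supported_mono (fun j hj => hj.1) hf
  have hg1 : g ∈ supported K {k | k ≠ i₁} := supported_mono (fun j hj => hj.2) hg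
  have s1 := isTame_X.update_add t hw
  have s2 := (s1.update_add i₀ a0).update_add i₁ a1
  have s3 := s2.update_add t (neg_mem hw)
  have s4 := (s3.update_add i₀ (neg_mem a0)).update_add i₁ (neg_mem a1)
  obtain ⟨E, hE, E0, E1, EX⟩ : ∃ E : PolyMap n K, IsTame E ∧
      E i₀ = X i₀ + X i₃ * (X i₀ * X i₂ - X i₁ * X i₃) ∧
      E i₁ = X i₁ + X i₂ * (X i₀ * X i₂ - X i₁ * X i₃) ∧
      ∀ j, j ≠ i₀ → j ≠ i₁ → E j = X j := by
    refine ⟨_, s4, ?_, ?_, fun j hj0 hj1 => ?_⟩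
    · simp only [map_neg, map_sub, map_mul, bind₁_X_right, Function.update_self, ne_eq,
        not_false_eq_true, Function.update_of_ne, h01, h0t, h1t, h2t, h3t,
        h01.symm, h02.symm, h03.symm, h12.symm, h13.symm, h0t.symm, h1t.symm]
      ring
    · simp only [map_neg, map_sub, map_mul, bind₁_X_right, Function.update_self, ne_eq,
        not_false_eq_true, Function.update_of_ne, h01, h0t, h1t, h2t, h3t,
        h01.symm, h02.symm, h03.symm, h12.symm, h13.symm, h0t.symm, h1t.symm]
      ring
    · rcases eq_or_ne j t with rfl | hjt
      · simp only [map_neg, map_sub, map_mul, bind₁_X_right, Function.update_self, ne_eq,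
          not_false_eq_true, Function.update_of_ne, h01, h0t, h1t, h2t, h3t,
          h01.symm, h02.symm, h03.symm, h12.symm, h13.symm, h0t.symm, h1t.symm]
        ring
      · simp [hj0, hj1, hjt]
  have s5 := (hE.update_add i₀ hf0).update_add i₁ hg1
  convert s5 using 1
  funext i
  have Ef := bind₁_eq_self (G := E) (fun j hj => EX j hj.1 hj.2) hf
  have Eg := bind₁_eq_self (G := Function.update E i₀ (E i₀ + bind₁ E f))
    (fun j hj => by rw [Function.update_of_ne hj.1, EX j hj.1 hj.2]) hg
  rcases eq_or_ne i i₀ with rfl | hi0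
  · rw [H0, Function.update_of_ne h01, Function.update_self, Ef, E0]
    ring
  · rcases eq_or_ne i i₁ with rfl | hi1
    · rw [H1, Function.update_self, Eg, Function.update_of_ne hi0, E1]
      ring
    · rw [H2 i hi0 hi1, Function.update_of_ne hi1, Function.update_of_ne hi0, EX i hi0 hi1,
        add_zero]

end NormalForm

end Tame

end PolyMap

namespace PolyMap

/-! ### Three cubics with dependent derivatives: the common one-form and the dual curve. -/

section Pencil

variable {K : Type*} [Field K] {n : ℕ}

theorem pderiv_comm (k l : Fin n) (u : MvPolynomial (Fin n) K) :
    pderiv k (pderiv l u) = pderiv l (pderiv k u) := by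
  have h : ⁅(pderiv k : Derivation K (MvPolynomial (Fin n) K) (MvPolynomial (Fin n) K)),
      (pderiv l : Derivation K (MvPolynomial (Fin n) K) (MvPolynomial (Fin n) K))⁆ = 0 := by
    apply MvPolynomial.derivation_ext
    intro i
    rw [Derivation.commutator_apply]
    classical
    simp [Pi.single_apply, apply_ite]
  have := congrArg (fun d => d u) h
  simpa [Derivation.commutator_apply, sub_eq_zero] using this

/-- Dependence of `f`, `∂ₖf`, `∂ₗf` makes the cross products `f × ∂ₖf` pairwise parallel. Dividing
the third coordinates by their gcd gives `f × ∂ₖf = Pₖ c`; the divisibility clause expresses that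
`P` is primitive. -/
theorem exists_primitive_factorization {f₁ f₂ f₃ : MvPolynomial (Fin n) K}
    (hdet : ∀ k l, f₁ * (pderiv k f₂ * pderiv l f₃ - pderiv l f₂ * pderiv k f₃) +
      f₂ * (pderiv k f₃ * pderiv l f₁ - pderiv l f₃ * pderiv k f₁) +
      f₃ * (pderiv k f₁ * pderiv l f₂ - pderiv l f₁ * pderiv k f₂) = 0)
    (h12 : ∃ k, f₁ * pderiv k f₂ - f₂ * pderiv k f₁ ≠ 0) :
    ∃ (c₁ c₂ c₃ : MvPolynomial (Fin n) K) (P : Fin n → MvPolynomial (Fin n) K),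
      c₃ ≠ 0 ∧ (∀ x y, (∀ k, x ∣ y * P k) → x ∣ y) ∧
      (∀ k, f₂ * pderiv k f₃ - f₃ * pderiv k f₂ = c₁ * P k) ∧
      (∀ k, f₃ * pderiv k f₁ - f₁ * pderiv k f₃ = c₂ * P k) ∧
      (∀ k, f₁ * pderiv k f₂ - f₂ * pderiv k f₁ = c₃ * P k) := by
  obtain ⟨k₀, hk₀⟩ := h12
  let _ : StrongNormalizationMonoid (MvPolynomial (Fin n) K) :=
    UniqueFactorizationMonoid.strongNormalizationMonoid
  let _ : NormalizedGCDMonoid (MvPolynomial (Fin n) K) :=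
    UniqueFactorizationMonoid.toNormalizedGCDMonoid _
  obtain ⟨P, hP, hP1⟩ := Finset.extract_gcd (s := Finset.univ)
    (fun k => f₁ * pderiv k f₂ - f₂ * pderiv k f₁) ⟨k₀, Finset.mem_univ _⟩
  set c₃ := Finset.univ.gcd fun k => f₁ * pderiv k f₂ - f₂ * pderiv k f₁ with hc₃
  have hP' : ∀ k, f₁ * pderiv k f₂ - f₂ * pderiv k f₁ = c₃ * P k := fun k =>
    hP k (Finset.mem_univ k)
  have h0 : c₃ * P k₀ ≠ 0 := by rw [← hP']; exact hk₀
  have hprim : ∀ x y, (∀ k, x ∣ y * P k) → x ∣ y := by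
    intro x y h
    have h1 : x ∣ Finset.univ.gcd fun k => y * P k := Finset.dvd_gcd fun k _ => h k
    have h2 := h1.trans (Finset.gcd_mul_left' Finset.univ P y).dvd
    rwa [hP1, mul_one] at h2
  have hdiv : ∀ g : Fin n → MvPolynomial (Fin n) K,
      (∀ k l, g k * P l = g l * P k) → ∃ c, ∀ k, g k = c * P k := by
    intro g hg
    obtain ⟨c, hc⟩ := hprim (P k₀) (g k₀) fun k => Dvd.intro_left (g k) (hg k k₀)
    refine ⟨c, fun k => mul_right_cancel₀ (right_ne_zero_of_mul h0) ?_⟩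
    rw [hg k k₀, hc]; ring
  obtain ⟨c₁, hc₁⟩ := hdiv (fun k => f₂ * pderiv k f₃ - f₃ * pderiv k f₂) fun k l => by
    refine mul_left_cancel₀ (left_ne_zero_of_mul h0) ?_
    linear_combination -f₂ * hdet k l - (f₂ * pderiv k f₃ - f₃ * pderiv k f₂) * hP' l +
      (f₂ * pderiv l f₃ - f₃ * pderiv l f₂) * hP' k
  obtain ⟨c₂, hc₂⟩ := hdiv (fun k => f₃ * pderiv k f₁ - f₁ * pderiv k f₃) fun k l => by
    refine mul_left_cancel₀ (left_ne_zero_of_mul h0) ?_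
    linear_combination f₁ * hdet k l - (f₃ * pderiv k f₁ - f₁ * pderiv k f₃) * hP' l +
      (f₃ * pderiv l f₁ - f₁ * pderiv l f₃) * hP' k
  exact ⟨c₁, c₂, c₃, P, left_ne_zero_of_mul h0, hprim, hc₁, hc₂, hP'⟩

/-- Differentiate the second and third coordinates of `f × ∂ₗf = Pₗ c` by `xₖ` and eliminate the
derivative of `Pₗ` between them; orthogonality of `c` to `f` and `∂f` simplifies the rest. -/
theorem mul_contraction_eq {f₁ f₂ f₃ c₁ c₂ c₃ : MvPolynomial (Fin n) K}
    {P : Fin n → MvPolynomial (Fin n) K}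
    (h2 : ∀ k, f₃ * pderiv k f₁ - f₁ * pderiv k f₃ = c₂ * P k)
    (h3 : ∀ k, f₁ * pderiv k f₂ - f₂ * pderiv k f₁ = c₃ * P k)
    (hcf : c₁ * f₁ + c₂ * f₂ + c₃ * f₃ = 0)
    (hcd : ∀ k, c₁ * pderiv k f₁ + c₂ * pderiv k f₂ + c₃ * pderiv k f₃ = 0) (k l : Fin n) :
    f₁ * (c₁ * pderiv k (pderiv l f₁) + c₂ * pderiv k (pderiv l f₂) +
      c₃ * pderiv k (pderiv l f₃)) = P l * (c₂ * pderiv k c₃ - c₃ * pderiv k c₂) := by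
  have e2 := congrArg (pderiv k) (h2 l)
  have e3 := congrArg (pderiv k) (h3 l)
  simp only [map_sub, pderiv_mul] at e2 e3
  linear_combination c₂ * e3 - c₃ * e2 + pderiv k (pderiv l f₁) * hcf +
    pderiv l f₁ * hcd k - pderiv k f₁ * hcd l

/-- The vector `c` traces the dual of the curve traced by `f`, so duality makes `c × ∂ₖc` parallel
to `f`. Symmetry of second derivatives and primitivity of `P` show that the factor is `β Pₖ` with
`β` a polynomial. -/
theorem exists_dual_factor {f₁ f₂ f₃ c₁ c₂ c₃ : MvPolynomial (Fin n) K}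
    {P : Fin n → MvPolynomial (Fin n) K}
    (hdet : ∀ k l, f₁ * (pderiv k f₂ * pderiv l f₃ - pderiv l f₂ * pderiv k f₃) +
      f₂ * (pderiv k f₃ * pderiv l f₁ - pderiv l f₃ * pderiv k f₁) +
      f₃ * (pderiv k f₁ * pderiv l f₂ - pderiv l f₁ * pderiv k f₂) = 0)
    (hf₁ : f₁ ≠ 0) {k₀ : Fin n} (hk₀ : P k₀ ≠ 0)
    (hprim : ∀ x y, (∀ k, x ∣ y * P k) → x ∣ y)
    (h1 : ∀ k, f₂ * pderiv k f₃ - f₃ * pderiv k f₂ = c₁ * P k)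
    (h2 : ∀ k, f₃ * pderiv k f₁ - f₁ * pderiv k f₃ = c₂ * P k)
    (h3 : ∀ k, f₁ * pderiv k f₂ - f₂ * pderiv k f₁ = c₃ * P k) :
    (c₁ * f₁ + c₂ * f₂ + c₃ * f₃ = 0) ∧
    ∃ β : MvPolynomial (Fin n) K,
      (∀ k l, c₁ * pderiv k (pderiv l f₁) + c₂ * pderiv k (pderiv l f₂) +
        c₃ * pderiv k (pderiv l f₃) = β * P k * P l) ∧
      (∀ k, c₂ * pderiv k c₃ - c₃ * pderiv k c₂ = β * P k * f₁) ∧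
      (∀ k, c₃ * pderiv k c₁ - c₁ * pderiv k c₃ = β * P k * f₂) ∧
      (∀ k, c₁ * pderiv k c₂ - c₂ * pderiv k c₁ = β * P k * f₃) := by
  have hcf : c₁ * f₁ + c₂ * f₂ + c₃ * f₃ = 0 := by
    refine mul_left_cancel₀ hk₀ ?_
    linear_combination -f₁ * h1 k₀ - f₂ * h2 k₀ - f₃ * h3 k₀
  have hcd : ∀ k, c₁ * pderiv k f₁ + c₂ * pderiv k f₂ + c₃ * pderiv k f₃ = 0 := by
    intro k
    refine mul_left_cancel₀ hk₀ ?_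
    linear_combination -pderiv k f₁ * h1 k₀ - pderiv k f₂ * h2 k₀ - pderiv k f₃ * h3 k₀ +
      hdet k₀ k
  have e1 := mul_contraction_eq h2 h3 hcf hcd
  have e2 := mul_contraction_eq (f₁ := f₂) (f₂ := f₃) (f₃ := f₁) (c₁ := c₂) (c₂ := c₃) (c₃ := c₁)
    h3 h1 (by linear_combination hcf) (fun k => by linear_combination hcd k)
  have e3 := mul_contraction_eq (f₁ := f₃) (f₂ := f₁) (f₃ := f₂) (c₁ := c₃) (c₂ := c₁) (c₃ := c₂)
    h1 h2 (by linear_combination hcf) (fun k => by linear_combination hcd k)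
  have hsymm : ∀ k l, P l * (c₂ * pderiv k c₃ - c₃ * pderiv k c₂) =
      P k * (c₂ * pderiv l c₃ - c₃ * pderiv l c₂) := by
    intro k l
    rw [← e1, ← e1, pderiv_comm k l, pderiv_comm k l, pderiv_comm k l]
  obtain ⟨Y, hY⟩ := hprim (P k₀) (c₂ * pderiv k₀ c₃ - c₃ * pderiv k₀ c₂) fun k =>
    ⟨_, (mul_comm _ _).trans (hsymm k k₀).symm⟩
  have hY' : ∀ k, c₂ * pderiv k c₃ - c₃ * pderiv k c₂ = P k * Y := fun k =>
    mul_left_cancel₀ hk₀ (by rw [hsymm k k₀, hY]; ring)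
  -- Primitivity is applied once for each index, removing `P k` and `P l` from a multiple of `f₁`.
  obtain ⟨β, hβ⟩ : f₁ ∣ Y := hprim _ _ fun k => hprim _ _ fun l =>
    ⟨c₁ * pderiv k (pderiv l f₁) + c₂ * pderiv k (pderiv l f₂) + c₃ * pderiv k (pderiv l f₃), by
      rw [e1, hY']; ring⟩
  have hS : ∀ k l, c₁ * pderiv k (pderiv l f₁) + c₂ * pderiv k (pderiv l f₂) +
      c₃ * pderiv k (pderiv l f₃) = β * P k * P l := fun k l =>
    mul_left_cancel₀ hf₁ (by rw [e1, hY', hβ]; ring)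
  refine ⟨hcf, β, hS, fun k => ?_, fun k => ?_, fun k => ?_⟩
  · rw [hY', hβ]; ring
  · refine mul_left_cancel₀ hk₀ ?_
    linear_combination f₂ * hS k k₀ - e2 k k₀
  · refine mul_left_cancel₀ hk₀ ?_
    linear_combination f₃ * hS k k₀ - e3 k k₀

/-- Differentiating `c · D²f = βP²` gives `c · D³f = P² Dβ + 3βP DP`. Differentiate again: the term
`c · D⁴f` is zero, and `c₃ Dc` equals `Dc₃ c` up to a multiple of `βP`. After multiplication by
`c₃`, every term except `3β(DP)²` is thus divisible by `P`. -/
theorem dvd_derivation_of_prime {R : Type*} [CommRing R] [IsDomain R] [Algebra K R]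
    (D : Derivation K R R) {f₁ f₂ f₃ c₁ c₂ c₃ P β : R} (hP : Prime P) (hc₃ : ¬ P ∣ c₃)
    (hβ : ¬ P ∣ β) (h3 : ¬ P ∣ 3)
    (h : f₁ * D f₂ - f₂ * D f₁ = c₃ * P)
    (g1 : c₂ * D c₃ - c₃ * D c₂ = β * P * f₁)
    (g2 : c₃ * D c₁ - c₁ * D c₃ = β * P * f₂)
    (hs : c₁ * D (D f₁) + c₂ * D (D f₂) + c₃ * D (D f₃) = β * P ^ 2)
    (hd1 : D (D (D (D f₁))) = 0) (hd2 : D (D (D (D f₂))) = 0) (hd3 : D (D (D (D f₃))) = 0) :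
    P ∣ D P := by
  have h0 : c₃ ≠ 0 := fun h => hc₃ (h ▸ dvd_zero P)
  have e := congrArg D h
  have es := congrArg D hs
  simp only [map_sub, map_add, Derivation.leibniz, Derivation.leibniz_pow, smul_eq_mul] at e es
  norm_num at es
  have ht : c₁ * D (D (D f₁)) + c₂ * D (D (D f₂)) + c₃ * D (D (D f₃)) =
      P ^ 2 * D β + 3 * β * P * D P := by
    refine mul_left_cancel₀ h0 ?_
    linear_combination c₃ * es - D c₃ * hs + D (D f₂) * g1 - D (D f₁) * g2 + β * P * e
  have et := congrArg D ht
  have h3' : D 3 = 0 := by simpa using D.map_natCast 3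
  simp only [map_add, Derivation.leibniz, Derivation.leibniz_pow, smul_eq_mul,
    hd1, hd2, hd3, h3'] at et
  norm_num at et
  have key : P ∣ c₃ * (3 * β * D P ^ 2) := by
    refine ⟨D c₃ * (P * D β + 3 * β * D P) + β * (f₂ * D (D (D f₁)) - f₁ * D (D (D f₂))) -
      c₃ * (2 * D P * D β + P * D (D β) + 3 * D β * D P + 3 * β * D (D P)), ?_⟩
    linear_combination -c₃ * et + D c₃ * ht - D (D (D f₂)) * g1 + D (D (D f₁)) * g2
  rcases hP.dvd_or_dvd key with h | h
  · exact absurd h hc₃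
  rcases hP.dvd_or_dvd h with h | h
  · rcases hP.dvd_or_dvd h with h | h
    · exact absurd h h3
    · exact absurd h hβ
  · exact hP.dvd_of_dvd_pow h

end Pencil

end PolyMap

namespace PolyMap

/-! ### The generic direction, and linearity of the primitive one-form. -/

section Pencil

variable {K : Type*} [Field K] {n : ℕ}

/-- The generic directional derivative `∑ v_k ∂/∂x_k` on `K[x][v]`, which treats the coordinates
`v_k` of the direction as constants. -/
noncomputable def genericDeriv (n : ℕ) (K : Type*) [Field K] :
    Derivation K (MvPolynomial (Fin n) (MvPolynomial (Fin n) K))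
      (MvPolynomial (Fin n) (MvPolynomial (Fin n) K)) :=
  let e := sumAlgEquiv K (Fin n) (Fin n)
  let D₀ : Derivation K (MvPolynomial (Fin n ⊕ Fin n) K) (MvPolynomial (Fin n ⊕ Fin n) K) :=
    mkDerivation K (Sum.elim 0 fun k => X (Sum.inl k))
  Derivation.mk' (e.toLinearMap ∘ₗ D₀.toLinearMap ∘ₗ e.symm.toLinearMap) fun a b => by
    simp [Derivation.leibniz]

theorem genericDeriv_X (k : Fin n) : genericDeriv n K (X k) = 0 := by
  have : (sumAlgEquiv K (Fin n) (Fin n)).symm (X k) = X (Sum.inl k) := by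
    rw [AlgEquiv.symm_apply_eq]; simp
  change sumAlgEquiv K _ _ (mkDerivation K _ ((sumAlgEquiv K _ _).symm (X k))) = _
  rw [this, mkDerivation_X]
  simp

theorem genericDeriv_C_X (k : Fin n) : genericDeriv n K (C (X k)) = X k := by
  have : (sumAlgEquiv K (Fin n) (Fin n)).symm (C (X k)) = X (Sum.inr k) := by
    rw [AlgEquiv.symm_apply_eq]; simp
  change sumAlgEquiv K _ _ (mkDerivation K _ ((sumAlgEquiv K _ _).symm (C (X k)))) = _
  rw [this, mkDerivation_X]
  simp

theorem genericDeriv_C (u : MvPolynomial (Fin n) K) :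
    genericDeriv n K (C u) = ∑ k, X k * C (pderiv k u) := by
  induction u using MvPolynomial.induction_on with
  | C a =>
    have : (C (C a) : MvPolynomial (Fin n) (MvPolynomial (Fin n) K)) = algebraMap K _ a := rfl
    rw [this, Derivation.map_algebraMap]
    simp
  | add p q hp hq => simp [hp, hq, mul_add, Finset.sum_add_distrib]
  | mul_X p i hp =>
    rw [C_mul, Derivation.leibniz, hp, genericDeriv_C_X]
    simp only [smul_eq_mul, Derivation.leibniz, pderiv_X, map_add, map_mul, mul_add,
      Finset.sum_add_distrib]
    congr 1
    · rw [Finset.sum_eq_single i]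
      · simp; ring
      · intro b _ hb; simp [hb.symm]
      · simp
    · rw [Finset.mul_sum]
      exact Finset.sum_congr rfl fun _ _ => by ring

theorem genericDeriv_sum (g : Fin n → MvPolynomial (Fin n) (MvPolynomial (Fin n) K)) :
    genericDeriv n K (∑ k, X k * g k) = ∑ k, X k * genericDeriv n K (g k) := by
  simp [map_sum, Derivation.leibniz, genericDeriv_X]

theorem genericDeriv_four_eq_zero {f : MvPolynomial (Fin n) K} (hf : f.IsHomogeneous 3) :
    genericDeriv n K (genericDeriv n K (genericDeriv n K (genericDeriv n K (C f)))) = 0 := by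
  have h : ∀ i j k l, pderiv i (pderiv j (pderiv k (pderiv l f))) = 0 := by
    intro i j k l
    have h0 := ((hf.pderiv (i := l)).pderiv (i := k)).pderiv (i := j)
    rw [← totalDegree_zero_iff_isHomogeneous, totalDegree_eq_zero_iff_eq_C] at h0
    rw [h0, pderiv_C]
  simp only [genericDeriv_C, genericDeriv_sum, h]
  simp

/-- The linear form `∑ P_k v_k` over `K[x]`. -/
noncomputable def linearForm (P : Fin n → MvPolynomial (Fin n) K) :
    MvPolynomial (Fin n) (MvPolynomial (Fin n) K) := ∑ k, X k * C (P k)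

theorem eval_linearForm (P v : Fin n → MvPolynomial (Fin n) K) :
    eval v (linearForm P) = ∑ k, v k * P k := by
  simp [linearForm]

theorem not_linearForm_dvd_C {P : Fin n → MvPolynomial (Fin n) K} {u : MvPolynomial (Fin n) K}
    (hu : u ≠ 0) : ¬ linearForm P ∣ C u := by
  rintro ⟨q, hq⟩
  have := congrArg (eval (0 : Fin n → MvPolynomial (Fin n) K)) hq
  rw [map_mul, eval_linearForm] at this
  simp at this
  exact hu this

theorem coeff_linearForm (P : Fin n → MvPolynomial (Fin n) K) (k : Fin n) :
    coeff (Finsupp.single k 1) (linearForm P) = P k := by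
  classical
  simp only [linearForm, coeff_sum, mul_comm (X _), coeff_C_mul, coeff_X]
  rw [Finset.sum_eq_single k]
  · simp
  · intro b _ hb
    rw [if_neg fun h => hb (Finsupp.single_left_injective one_ne_zero h)]; simp
  · simp

/-- A form of degree one in `v` can only split off a factor from `K[x]`, and primitivity makes such
a factor a unit. -/
theorem prime_linearForm {P : Fin n → MvPolynomial (Fin n) K} {k₀ : Fin n} (hk₀ : P k₀ ≠ 0)
    (hprim : ∀ x y, (∀ k, x ∣ y * P k) → x ∣ y) : Prime (linearForm P) := by
  have hne : linearForm P ≠ 0 := fun h => hk₀ (by rw [← coeff_linearForm P k₀, h, coeff_zero])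
  have hhom : (linearForm P).IsHomogeneous 1 :=
    IsHomogeneous.sum _ _ _ fun k _ => by
      rw [mul_comm]; exact (isHomogeneous_X _ k).C_mul _
  refine (irreducible_of_totalDegree_eq_one (hhom.totalDegree hne) fun x hx => ?_).prime
  refine isUnit_of_dvd_one (hprim x 1 fun k => ?_)
  rw [one_mul, ← coeff_linearForm P k]
  exact hx _

-- The primitive one-form behind the Wronskians turns out to be linear with constant skew Jacobian,
-- and integrability forces that skew matrix to have rank two. This is what bounds the number of
-- essential directions by two.
set_option maxHeartbeats 800000 in
theorem exists_pencil (h6 : (6 : K) ≠ 0) {f₁ f₂ f₃ : MvPolynomial (Fin n) K}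
    (hf₁ : f₁.IsHomogeneous 3) (hf₂ : f₂.IsHomogeneous 3) (hf₃ : f₃.IsHomogeneous 3)
    (hind : ∀ a b c : K, C a * f₁ + C b * f₂ + C c * f₃ = 0 → a = 0 ∧ b = 0 ∧ c = 0)
    (hdet : ∀ k l, f₁ * (pderiv k f₂ * pderiv l f₃ - pderiv l f₂ * pderiv k f₃) +
      f₂ * (pderiv k f₃ * pderiv l f₁ - pderiv l f₃ * pderiv k f₁) +
      f₃ * (pderiv k f₁ * pderiv l f₂ - pderiv l f₁ * pderiv k f₂) = 0) :
    (∃ k, f₁ * pderiv k f₂ - f₂ * pderiv k f₁ ≠ 0) ∧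
    ∃ (j k : Fin n) (s t : Fin n → K), ∀ i, f₁ * pderiv i f₂ - f₂ * pderiv i f₁ =
      C (s i) * (f₁ * pderiv j f₂ - f₂ * pderiv j f₁) +
      C (t i) * (f₁ * pderiv k f₂ - f₂ * pderiv k f₁) := by
  have h3 : (3 : K) ≠ 0 := fun h => h6 (by linear_combination 2 * h)
  have h2 : (2 : K) ≠ 0 := fun h => h6 (by linear_combination 3 * h)
  have hf₁0 : f₁ ≠ 0 := by
    rintro rfl
    exact one_ne_zero (hind 1 0 0 (by simp)).1
  have hW : ∃ k, f₁ * pderiv k f₂ - f₂ * pderiv k f₁ ≠ 0 := by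
    by_contra! hW
    obtain ⟨a, ha⟩ := eq_C_mul_of_wronskian_eq_zero h6 (f := f₂) (g := f₁)
      (hf₂.totalDegree_le.trans (by norm_num)) (hf₁.totalDegree_le.trans (by norm_num)) hf₁0
      fun k => by linear_combination -hW k
    have := (hind a (-1) 0 (by rw [ha]; simp)).2.1
    simp at this
  refine ⟨hW, ?_⟩
  obtain ⟨c₁, c₂, c₃, P, hc₃, hprim, e1, e2, e3⟩ := exists_primitive_factorization hdet hW
  obtain ⟨k₀, hk₀⟩ : ∃ k₀, P k₀ ≠ 0 := by
    obtain ⟨k, hk⟩ := hW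
    exact ⟨k, fun h => hk (by rw [e3, h, mul_zero])⟩
  obtain ⟨hcf, β, hS, g1, g2, g3⟩ := exists_dual_factor hdet hf₁0 hk₀ hprim e1 e2 e3
  -- Because `f₁` and `f₂` have equal degree, the two Euler contributions cancel. This excludes a
  -- constant `P`, which bounds the degrees of the `cᵢ` by 4 and later supplies a nonzero
  -- derivative.
  have hEuler : ∑ k, X k * P k = 0 := by
    refine mul_left_cancel₀ hc₃ ?_
    have E1 := hf₁.sum_X_mul_pderiv
    have E2 := hf₂.sum_X_mul_pderiv
    calc c₃ * ∑ k, X k * P k = ∑ k, X k * (c₃ * P k) := by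
          rw [Finset.mul_sum]; exact Finset.sum_congr rfl fun _ _ => by ring
      _ = f₁ * (∑ k, X k * pderiv k f₂) - f₂ * ∑ k, X k * pderiv k f₁ := by
          rw [Finset.mul_sum, Finset.mul_sum, ← Finset.sum_sub_distrib]
          exact Finset.sum_congr rfl fun k _ => by rw [← e3]; ring
      _ = c₃ * 0 := by rw [E1, E2]; simp only [nsmul_eq_mul]; ring
  have hnonconst : ¬ ∀ j k, pderiv j (P k) = 0 := by
    intro h
    apply hk₀
    have := congrArg (pderiv k₀) hEuler
    simp only [map_sum, pderiv_mul, h, mul_zero, add_zero, map_zero, pderiv_X,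
      Pi.single_apply] at this
    simpa using this
  have hdeg : ∀ {a b : MvPolynomial (Fin n) K}, a.IsHomogeneous 3 → b.IsHomogeneous 3 →
      ∀ k, (a * pderiv k b - b * pderiv k a).totalDegree ≤ 5 := by
    intro a b ha hb k
    exact ((ha.mul (hb.pderiv (i := k))).sub (hb.mul (ha.pderiv (i := k)))).totalDegree_le
  have hcdeg : ∀ {c : MvPolynomial (Fin n) K}, (∀ k, (c * P k).totalDegree ≤ 5) →
      c.totalDegree ≤ 4 := by
    intro c hc
    by_contra hlt
    have hc0 : c ≠ 0 := by rintro rfl; simp at hlt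
    refine hnonconst fun j k => ?_
    by_cases hPk : P k = 0
    · rw [hPk, map_zero]
    have := hc k
    rw [totalDegree_mul_of_isDomain hc0 hPk] at this
    rw [totalDegree_eq_zero_iff_eq_C.1 (show (P k).totalDegree = 0 by omega), pderiv_C]
  have d1 : c₁.totalDegree ≤ 4 := hcdeg fun k => by rw [← e1]; exact hdeg hf₂ hf₃ k
  have d2 : c₂.totalDegree ≤ 4 := hcdeg fun k => by rw [← e2]; exact hdeg hf₃ hf₁ k
  have d3 : c₃.totalDegree ≤ 4 := hcdeg fun k => by rw [← e3]; exact hdeg hf₁ hf₂ k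
  -- If `β` vanished, the dual vector `c` would be constant up to a factor, and `c · f = 0` would be
  -- a linear relation over `K` among the `fᵢ`.
  have hβ : β ≠ 0 := by
    rintro rfl
    obtain ⟨a, ha⟩ := eq_C_mul_of_wronskian_eq_zero h6 d1 d3 hc₃ fun k => by
      linear_combination -g2 k
    obtain ⟨b, hb⟩ := eq_C_mul_of_wronskian_eq_zero h6 d2 d3 hc₃ fun k => by
      linear_combination g1 k
    have := (hind a b 1 (mul_left_cancel₀ hc₃ (by
      rw [map_one]; linear_combination hcf - f₁ * ha - f₂ * hb))).2.2
    exact one_ne_zero this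
  -- the linear form divides its generic derivative
  have hprime := prime_linearForm hk₀ hprim
  have hCeq : ∀ {a b c : MvPolynomial (Fin n) K},
      (∀ k, a * pderiv k b - b * pderiv k a = c * P k) →
      C a * genericDeriv n K (C b) - C b * genericDeriv n K (C a) = C c * linearForm P := by
    intro a b c h
    simp only [genericDeriv_C, linearForm, Finset.mul_sum]
    rw [← Finset.sum_sub_distrib]
    refine Finset.sum_congr rfl fun k _ => ?_
    have := congrArg (C : _ → MvPolynomial (Fin n) (MvPolynomial (Fin n) K)) (h k)
    simp only [map_sub, map_mul] at this
    linear_combination X k * this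
  have hdvd := dvd_derivation_of_prime (genericDeriv n K) (f₁ := C f₁) (f₂ := C f₂) (f₃ := C f₃)
    (c₁ := C c₁) (c₂ := C c₂) (c₃ := C c₃) (β := C β) hprime (not_linearForm_dvd_C hc₃)
    (not_linearForm_dvd_C hβ)
    (by
      have : (3 : MvPolynomial (Fin n) (MvPolynomial (Fin n) K)) = C (C 3) := by
        rw [map_ofNat, map_ofNat]
      rw [this]
      exact not_linearForm_dvd_C (by simpa using h3))
    (hCeq e3)
    (by
      rw [hCeq (c := β * f₁) fun k => by rw [g1]; ring]
      simp only [map_mul]; ring)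
    (by
      rw [hCeq (c := β * f₂) fun k => by rw [g2]; ring]
      simp only [map_mul]; ring)
    (by
      simp only [genericDeriv_C, genericDeriv_sum, linearForm, sq, Finset.mul_sum, Finset.sum_mul,
        ← Finset.sum_add_distrib]
      refine Finset.sum_congr rfl fun k _ => Finset.sum_congr rfl fun l _ => ?_
      have := congrArg (C : _ → MvPolynomial (Fin n) (MvPolynomial (Fin n) K)) (hS l k)
      simp only [map_add, map_mul] at this
      linear_combination X k * X l * this)
    (genericDeriv_four_eq_zero hf₁) (genericDeriv_four_eq_zero hf₂) (genericDeriv_four_eq_zero hf₃)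
  -- Specializing the generic direction to constants turns the divisibility into one that degree
  -- considerations allow only for zero.
  have hkill : ∀ v : Fin n → K, dirDeriv v (∑ k, C (v k) * P k) = 0 := by
    intro v
    apply dirDeriv_eq_zero_of_dvd
    have := map_dvd (eval fun k => C (v k)) hdvd
    rw [eval_linearForm, linearForm, genericDeriv_sum] at this
    convert this using 1
    simp only [genericDeriv_C, map_sum, map_mul, eval_X, eval_C, dirDeriv_apply, pderiv_C_mul,
      Finset.mul_sum]
    exact Finset.sum_congr rfl fun _ _ => Finset.sum_congr rfl fun _ _ => by ring
  have hdiag : ∀ k, pderiv k (P k) = 0 := by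
    intro k
    have := hkill (Pi.single k 1)
    rw [dirDeriv_single, Finset.sum_eq_single k] at this
    · simpa using this
    · intro b _ hb; simp [hb]
    · simp
  have hanti : ∀ k l, pderiv k (P l) = -pderiv l (P k) := by
    intro k l
    have := hkill (Pi.single k 1 + Pi.single l 1)
    simp only [Pi.add_apply, map_add, add_mul, Finset.sum_add_distrib, dirDeriv_add,
      dirDeriv_single] at this
    rw [Finset.sum_eq_single k (fun b _ hb => by simp [hb]) (by simp),
      Finset.sum_eq_single l (fun b _ hb => by simp [hb]) (by simp)] at this
    simp only [Pi.single_eq_same, map_one, one_mul, hdiag] at this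
    linear_combination this
  -- These quantities are symmetric in the first two indices and skew in the last two, so each
  -- equals its own negative.
  have hsecond : ∀ i j k, pderiv i (pderiv j (P k)) = 0 := by
    intro i j k
    have a1 : ∀ i j k, pderiv i (pderiv j (P k)) = -pderiv i (pderiv k (P j)) := fun i j k => by
      rw [hanti j k, map_neg]
    have h := a1 i j k
    rw [pderiv_comm i k, a1 k i j, pderiv_comm k j, a1 j k i, pderiv_comm j i] at h
    have h2' : (2 : MvPolynomial (Fin n) K) ≠ 0 := by
      have : (2 : MvPolynomial (Fin n) K) = C 2 := (map_ofNat C 2).symm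
      rw [this]; simpa using h2
    exact (mul_eq_zero.1 (show (2 : MvPolynomial (Fin n) K) * pderiv i (pderiv j (P k)) = 0 by
      linear_combination h)).resolve_left h2'
  have hPdeg : ∀ k, (P k).totalDegree ≤ 5 := by
    intro k
    by_cases hPk : P k = 0
    · simp [hPk]
    have := hdeg hf₁ hf₂ k
    rw [e3, totalDegree_mul_of_isDomain hc₃ hPk] at this
    omega
  have hconst : ∀ j k, ∃ a, pderiv j (P k) = C a := fun j k =>
    eq_C_of_pderiv_eq_zero h6 ((totalDegree_pderiv_le _ _).trans (by have := hPdeg k; omega))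
      fun i => hsecond i j k
  choose π hπ using hconst
  -- The form `ω = f₁ df₂ - f₂ df₁` satisfies `dω = 2 df₁ ∧ df₂`, hence `ω ∧ dω = 0`. As `ω = c₃ P`,
  -- the factor `c₃²` cancels.
  have hintM : ∀ i j k, P i * (pderiv j (P k) - pderiv k (P j)) +
      P j * (pderiv k (P i) - pderiv i (P k)) + P k * (pderiv i (P j) - pderiv j (P i)) = 0 := by
    intro i j k
    have dM : ∀ i j, pderiv i f₁ * pderiv j f₂ + f₁ * pderiv i (pderiv j f₂) -
        (pderiv i f₂ * pderiv j f₁ + f₂ * pderiv i (pderiv j f₁)) =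
        pderiv i c₃ * P j + c₃ * pderiv i (P j) := by
      intro i j
      have := congrArg (pderiv i) (e3 j)
      simpa only [map_sub, pderiv_mul] using this
    have cm : ∀ i j, pderiv i f₁ * pderiv j f₂ - pderiv i f₂ * pderiv j f₁ -
        (pderiv j f₁ * pderiv i f₂ - pderiv j f₂ * pderiv i f₁) =
        pderiv i c₃ * P j + c₃ * pderiv i (P j) - (pderiv j c₃ * P i + c₃ * pderiv j (P i)) := by
      intro i j
      linear_combination dM i j - dM j i - f₁ * pderiv_comm i j f₂ + f₂ * pderiv_comm i j f₁
    refine mul_left_cancel₀ (mul_ne_zero hc₃ hc₃) ?_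
    linear_combination -(c₃ * P i) * cm j k - (c₃ * P j) * cm k i - (c₃ * P k) * cm i j -
      2 * (pderiv j f₁ * pderiv k f₂ - pderiv j f₂ * pderiv k f₁) * e3 i -
      2 * (pderiv k f₁ * pderiv i f₂ - pderiv k f₂ * pderiv i f₁) * e3 j -
      2 * (pderiv i f₁ * pderiv j f₂ - pderiv i f₂ * pderiv j f₁) * e3 k
  push Not at hnonconst
  obtain ⟨j, k, hjk⟩ := hnonconst
  have hπjk : π j k ≠ 0 := fun h => hjk (by rw [hπ, h, map_zero])
  -- The coefficients come from solving `P ∧ dP = 0` for `P i`, with `π j k` as the nonzero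
  -- constant.
  refine ⟨j, k, fun i => -(π k i / π j k), fun i => π j i / π j k, fun i => ?_⟩
  have h0 := hintM i j k
  rw [hanti k j, hanti i k, hanti i j, hπ, hπ, hπ] at h0
  have key : P i = C (-(π k i / π j k)) * P j + C (π j i / π j k) * P k := by
    have hC : (C (π j k) : MvPolynomial (Fin n) K) ≠ 0 := by simpa using hπjk
    refine mul_left_cancel₀ hC ?_
    have q1 : (C (π j k) : MvPolynomial (Fin n) K) * C (-(π k i / π j k)) = - C (π k i) := by
      rw [← C_mul, ← C_neg]; congr 1; field_simp
    have q2 : (C (π j k) : MvPolynomial (Fin n) K) * C (π j i / π j k) = C (π j i) := by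
      rw [← C_mul]; congr 1; field_simp
    have h2' : (2 : MvPolynomial (Fin n) K) ≠ 0 := by
      have : (2 : MvPolynomial (Fin n) K) = C 2 := (map_ofNat C 2).symm
      rw [this]; simpa using h2
    refine mul_left_cancel₀ h2' ?_
    linear_combination h0 - 2 * P j * q1 - 2 * P k * q2
  rw [e3, e3, e3, key]
  ring

end Pencil

end PolyMap

namespace PolyMap

/-! ### From rank conditions to Wronskian identities and constant ratios. -/

section Rank

variable {K : Type*} [Field K] {n : ℕ}

theorem det_submatrix_eq_zero {H : PolyMap n K} {r : ℕ} (hr : H.jacobianRank ≤ r)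
    (p q : Fin (r + 1) → Fin n) : (H.jacobian.submatrix p q).det = 0 := by
  by_contra h
  let φ := algebraMap (MvPolynomial (Fin n) K) (FractionRing (MvPolynomial (Fin n) K))
  have h1 : ((H.jacobian.map φ).submatrix p q).det ≠ 0 := by
    have : ((H.jacobian.map φ).submatrix p q).det = φ (H.jacobian.submatrix p q).det := by
      rw [RingHom.map_det]; rfl
    rw [this]
    exact fun h' => h ((map_eq_zero_iff φ (IsFractionRing.injective _ _)).1 h')
  have h2 := Matrix.rank_of_isUnit _ ((Matrix.isUnit_iff_isUnit_det _).2 h1.isUnit)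
  rw [Fintype.card_fin] at h2
  have h3 := Matrix.rank_submatrix_le (H.jacobian.map φ) p q
  have h4 : (H.jacobian.map φ).rank ≤ r := hr
  omega

theorem wronskian_eq_zero (h6 : (6 : K) ≠ 0) {H : PolyMap n K} (hH : ∀ i, (H i).IsHomogeneous 3)
    (hr : H.jacobianRank ≤ 1) (a b k : Fin n) :
    H a * pderiv k (H b) = H b * pderiv k (H a) := by
  have h3 : (C 3 : MvPolynomial (Fin n) K) ≠ 0 := by
    simpa using (fun h => h6 (by linear_combination 2 * h) : (3 : K) ≠ 0)
  have hm : ∀ i, pderiv i (H a) * pderiv k (H b) = pderiv i (H b) * pderiv k (H a) := by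
    intro i
    have := det_submatrix_eq_zero hr ![a, b] ![i, k]
    rw [Matrix.det_fin_two] at this
    simp [jacobian] at this
    linear_combination this
  have Ea := (hH a).sum_X_mul_pderiv
  have Eb := (hH b).sum_X_mul_pderiv
  refine mul_left_cancel₀ h3 ?_
  have e3 : (C 3 : MvPolynomial (Fin n) K) = 3 := map_ofNat C 3
  rw [nsmul_eq_mul] at Ea Eb
  push_cast at Ea Eb
  rw [e3, ← mul_assoc, ← mul_assoc, ← Ea, ← Eb, Finset.sum_mul, Finset.sum_mul]
  exact Finset.sum_congr rfl fun i _ => by linear_combination X i * hm i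

/-- Euler's formula contracts one column of the vanishing 3×3 minors with `x`, replacing derivatives
by the components themselves; the factor 3 is cancelled. -/
theorem euler_minor_eq_zero (h6 : (6 : K) ≠ 0) {H : PolyMap n K}
    (hH : ∀ i, (H i).IsHomogeneous 3) (hr : H.jacobianRank ≤ 2) (a b c k l : Fin n) :
    H a * (pderiv k (H b) * pderiv l (H c) - pderiv l (H b) * pderiv k (H c)) +
      H b * (pderiv k (H c) * pderiv l (H a) - pderiv l (H c) * pderiv k (H a)) +
      H c * (pderiv k (H a) * pderiv l (H b) - pderiv l (H a) * pderiv k (H b)) = 0 := by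
  have h3 : (C 3 : MvPolynomial (Fin n) K) ≠ 0 := by
    simpa using (fun h => h6 (by linear_combination 2 * h) : (3 : K) ≠ 0)
  have hm : ∀ i, pderiv i (H a) * (pderiv k (H b) * pderiv l (H c) -
        pderiv l (H b) * pderiv k (H c)) +
      pderiv i (H b) * (pderiv k (H c) * pderiv l (H a) - pderiv l (H c) * pderiv k (H a)) +
      pderiv i (H c) * (pderiv k (H a) * pderiv l (H b) - pderiv l (H a) * pderiv k (H b)) = 0 := by
    intro i
    have := det_submatrix_eq_zero hr ![a, b, c] ![i, k, l]
    rw [Matrix.det_fin_three] at this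
    simp [jacobian] at this
    linear_combination this
  have Ea := (hH a).sum_X_mul_pderiv
  have Eb := (hH b).sum_X_mul_pderiv
  have Ec := (hH c).sum_X_mul_pderiv
  refine mul_left_cancel₀ h3 ?_
  have e3 : (C 3 : MvPolynomial (Fin n) K) = 3 := map_ofNat C 3
  rw [nsmul_eq_mul] at Ea Eb Ec
  push_cast at Ea Eb Ec
  rw [e3, mul_add, mul_add, ← mul_assoc, ← mul_assoc, ← mul_assoc, ← Ea, ← Eb, ← Ec,
    Finset.sum_mul, Finset.sum_mul, Finset.sum_mul, ← Finset.sum_add_distrib,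
    ← Finset.sum_add_distrib, mul_zero]
  exact Finset.sum_eq_zero fun i _ => by linear_combination X i * hm i

theorem exists_three_independent {H : PolyMap n K}
    (h : 3 ≤ Module.finrank K (Submodule.span K (Set.range H))) :
    ∃ a b c : Fin n, ∀ x y z : K, C x * H a + C y * H b + C z * H c = 0 →
      x = 0 ∧ y = 0 ∧ z = 0 := by
  classical
  obtain ⟨s, hs, hspan, hli⟩ := exists_linearIndependent K (Set.range H)
  have hfin : s.Finite := (Set.finite_range H).subset hs
  have := hfin.fintype
  rw [← hspan, finrank_span_set_eq_card hli] at h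
  have hcard : Fintype.card (Fin 3) ≤ Fintype.card s := by
    rw [Fintype.card_fin, ← Set.toFinset_card]; exact h
  obtain ⟨e⟩ := Function.Embedding.nonempty_of_card_le hcard
  have hli' := hli.comp e e.injective
  rw [Fintype.linearIndependent_iff] at hli'
  choose p hp using fun i : Fin 3 => hs (e i).2
  refine ⟨p 0, p 1, p 2, fun x y z hxyz => ?_⟩
  have := hli' ![x, y, z] (by
    simp only [Fin.sum_univ_three, Function.comp_apply, ← hp, smul_eq_C_mul]
    simpa using hxyz)
  exact ⟨this 0, this 1, this 2⟩

/-- By `exists_pencil`, the constant directions annihilating one Wronskian form a subspace of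
codimension at most two. All ratios of components are constant along them, and they become the
coordinate directions from the third on. -/
theorem exists_conj_parallel (h6 : (6 : K) ≠ 0) {H : PolyMap n K}
    (hH : ∀ i, (H i).IsHomogeneous 3) (hr : H.jacobianRank ≤ 2)
    (h : 3 ≤ Module.finrank K (Submodule.span K (Set.range H))) :
    ∃ T : Matrix.GeneralLinearGroup (Fin n) K, ∀ j : Fin n, 2 ≤ j.val → ∀ a b,
      conj T H a * pderiv j (conj T H b) = conj T H b * pderiv j (conj T H a) := by
  obtain ⟨a₁, a₂, a₃, hind⟩ := exists_three_independent h
  obtain ⟨⟨l, hl⟩, j, k, s, t, hst⟩ := exists_pencil h6 (hH a₁) (hH a₂) (hH a₃) hind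
    (euler_minor_eq_zero h6 hH hr a₁ a₂ a₃)
  set M : Fin n → MvPolynomial (Fin n) K :=
    fun i => H a₁ * pderiv i (H a₂) - H a₂ * pderiv i (H a₁) with hM
  have hf₁ : H a₁ ≠ 0 := fun h0 => one_ne_zero (hind 1 0 0 (by simp [h0])).1
  let φ := Fintype.linearCombination K M
  have h1 := LinearMap.finrank_range_add_finrank_ker φ
  rw [Fintype.range_linearCombination, Module.finrank_fin_fun] at h1
  have h2 : Module.finrank K (Submodule.span K (Set.range M)) ≤ 2 := by
    classical
    have hle : Submodule.span K (Set.range M) ≤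
        Submodule.span K (({M j, M k} : Finset _) : Set (MvPolynomial (Fin n) K)) := by
      rw [Submodule.span_le]
      rintro _ ⟨i, rfl⟩
      rw [SetLike.mem_coe, show M i = C (s i) * M j + C (t i) * M k from hst i,
        ← smul_eq_C_mul, ← smul_eq_C_mul]
      exact add_mem (Submodule.smul_mem _ _ (Submodule.subset_span (by simp)))
        (Submodule.smul_mem _ _ (Submodule.subset_span (by simp)))
    exact (Submodule.finrank_mono hle).trans
      ((finrank_span_finset_le_card _).trans Finset.card_le_two)
  obtain ⟨T, hT⟩ := exists_GL_col_mem 2 (LinearMap.ker φ) (by omega)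
  have key : ∀ v : Fin n → K, v ∈ LinearMap.ker φ → ∀ a b,
      H a * dirDeriv v (H b) = H b * dirDeriv v (H a) := by
    intro v hv
    have hv' : ∑ i, C (v i) * M i = 0 := by
      rw [LinearMap.mem_ker, Fintype.linearCombination_apply] at hv
      simpa only [smul_eq_C_mul] using hv
    have hm : ∀ m, H a₁ * dirDeriv v (H m) = H m * dirDeriv v (H a₁) := by
      intro m
      rw [← sub_eq_zero]
      refine mul_left_cancel₀ hl ?_
      -- The Wronskian of `H a₁` with any component is proportional to `M` over `K(x)`, so a
      -- direction annihilating `M` annihilates it as well.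
      have hk : ∀ k, M l * (H a₁ * pderiv k (H m) - H m * pderiv k (H a₁)) =
          M k * (H a₁ * pderiv l (H m) - H m * pderiv l (H a₁)) := fun k => by
        linear_combination -H a₁ * euler_minor_eq_zero h6 hH hr a₁ a₂ m k l
      calc M l * (H a₁ * dirDeriv v (H m) - H m * dirDeriv v (H a₁))
          = ∑ k, C (v k) * (M l * (H a₁ * pderiv k (H m) - H m * pderiv k (H a₁))) := by
            simp only [dirDeriv_apply, Finset.mul_sum, ← Finset.sum_sub_distrib]
            exact Finset.sum_congr rfl fun _ _ => by ring
        _ = (∑ k, C (v k) * M k) * (H a₁ * pderiv l (H m) - H m * pderiv l (H a₁)) := by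
            rw [Finset.sum_mul]
            exact Finset.sum_congr rfl fun k _ => by rw [hk]; ring
        _ = M l * 0 := by rw [hv']; ring
    intro a b
    refine mul_left_cancel₀ hf₁ ?_
    linear_combination H a * hm b - H b * hm a
  refine ⟨T, fun j hj a b => ?_⟩
  rw [pderiv_conj, pderiv_conj, conj_apply, conj_apply, Finset.sum_mul_sum, Finset.sum_mul_sum,
    Finset.sum_comm]
  refine Finset.sum_congr rfl fun x _ => Finset.sum_congr rfl fun y _ => ?_
  have := congrArg (bind₁ (linear T.1)) (key _ (hT j hj) y x)
  simp only [map_mul] at this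
  linear_combination C ((T⁻¹).1 a y) * C ((T⁻¹).1 b x) * this

end Rank

end PolyMap

namespace PolyMap

/-! ### Triangularizing maps of the form `L Q` with `Q` in two variables. -/

section Parallel

variable {K : Type*} [Field K] {n : ℕ}

/-- The transvection `1 + κ E_{ij}`, as an element of the general linear group. -/
def transvectionGL (i j : Fin n) (hij : i ≠ j) (κ : K) : Matrix.GeneralLinearGroup (Fin n) K where
  val := Matrix.transvection i j κ
  inv := Matrix.transvection i j (-κ)
  val_inv := by rw [Matrix.transvection_mul_transvection_same _ _ hij]; simp
  inv_val := by rw [Matrix.transvection_mul_transvection_same _ _ hij]; simp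

section Transvection

variable (i j : Fin n) (hij : i ≠ j) (κ : K) (H : PolyMap n K)

theorem conj_transvectionGL_self :
    conj (transvectionGL i j hij κ) H i =
      bind₁ (linear (transvectionGL i j hij κ).1) (H i - C κ * H j) := by
  have h : ((transvectionGL i j hij κ)⁻¹).1 = 1 + Matrix.single i j (-κ) := rfl
  have h' : ∀ k, C ((1 + Matrix.single i j (-κ) : Matrix (Fin n) (Fin n) K) i k) =
      (if k = i then 1 else 0) + if k = j then -C (σ := Fin n) κ else 0 := by
    intro k
    rw [Matrix.add_apply, Matrix.one_apply, Matrix.single_apply, map_add]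
    congr 1
    · split_ifs with h1 h2 h2 <;> first | exact absurd h1.symm h2 | exact absurd h2.symm h1 | simp
    · by_cases hk : k = j
      · simp [hk]
      · simp [hk, Ne.symm hk]
  rw [conj_apply, h]
  simp only [h', add_mul, Finset.sum_add_distrib, ite_mul, one_mul, zero_mul, Finset.sum_ite_eq',
    Finset.mem_univ, if_true, map_sub, map_mul, bind₁_C_right]
  ring

theorem conj_transvectionGL_of_ne {a : Fin n} (ha : a ≠ i) :
    conj (transvectionGL i j hij κ) H a =
      bind₁ (linear (transvectionGL i j hij κ).1) (H a) := by
  have h : ((transvectionGL i j hij κ)⁻¹).1 = 1 + Matrix.single i j (-κ) := rfl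
  rw [conj_apply, h]
  simp [Matrix.add_apply, Matrix.one_apply, apply_ite, ha.symm]

theorem pderiv_transvectionGL_self (u : MvPolynomial (Fin n) K) :
    pderiv j (bind₁ (linear (transvectionGL i j hij κ).1) u) =
      bind₁ (linear (transvectionGL i j hij κ).1) (pderiv j u + C κ * pderiv i u) := by
  rw [pderiv_bind₁_linear]
  have h : (transvectionGL i j hij κ).1 = 1 + Matrix.single i j κ := rfl
  have : (fun l => (transvectionGL i j hij κ).1 l j) = Pi.single j 1 + κ • Pi.single i 1 := by
    ext l
    rw [h]
    simp [Matrix.add_apply, Matrix.one_apply, Matrix.single_apply, Pi.single_apply, eq_comm]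
  rw [this, dirDeriv_add, dirDeriv_smul, dirDeriv_single, dirDeriv_single]

theorem pderiv_transvectionGL_of_ne {a : Fin n} (ha : a ≠ j) (u : MvPolynomial (Fin n) K) :
    pderiv a (bind₁ (linear (transvectionGL i j hij κ).1) u) =
      bind₁ (linear (transvectionGL i j hij κ).1) (pderiv a u) := by
  rw [pderiv_bind₁_linear]
  have h : (transvectionGL i j hij κ).1 = 1 + Matrix.single i j κ := rfl
  have : (fun l => (transvectionGL i j hij κ).1 l a) = Pi.single a 1 := by
    ext l
    rw [h]
    simp [Matrix.add_apply, Matrix.one_apply, Pi.single_apply, ha.symm]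
  rw [this, dirDeriv_single]

end Transvection

variable {p q : Fin n} {H Q : PolyMap n K} {L : MvPolynomial (Fin n) K}

/-- Three heights suffice: indices with `Q i = 0`, which include `p` and all variables of `L`, then
`q`, then the rest. The trace condition removes the diagonal entry at `q`. -/
theorem similarToTriangular_of_factor_aux (hpq : p ≠ q) (hL0 : L ≠ 0)
    (hnil : IsNilpotent H.jacobian)
    (hH : ∀ i, H i = L * Q i) (hLp : pderiv p L = 0) (hLq : pderiv q L = 0)
    (hLQ : ∀ i, pderiv i L = 0 ∨ Q i = 0)
    (hQ : ∀ l, l ≠ p → l ≠ q → ∀ i, pderiv l (Q i) = 0) (hQp : Q p = 0) :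
    SimilarToTriangular H.jacobian := by
  classical
  have htr := trace_eq_zero hnil
  have hterm : ∀ i, i ≠ q → pderiv i (H i) = 0 := by
    intro i hi
    rw [hH, pderiv_mul]
    rcases eq_or_ne i p with rfl | hip
    · simp [hQp]
    · rw [hQ i hip hi]
      rcases hLQ i with h | h <;> simp [h]
  rw [Finset.sum_eq_single q (fun b _ hb => hterm b hb) (by simp), hH, pderiv_mul, hLq, zero_mul,
    zero_add] at htr
  have hqq : pderiv q (Q q) = 0 := (mul_eq_zero.1 htr).resolve_left hL0
  refine similarToTriangular_of_height (fun i => if Q i = 0 then 0 else if i = q then 1 else 2)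
    fun i j hij => ?_
  rw [hH, pderiv_mul]
  by_cases hi : Q i = 0
  · simp [hi]
  have hj : Q j ≠ 0 := by
    intro hj
    simp only [hi, hj, if_true, if_false] at hij
    split_ifs at hij <;> omega
  have hLj : pderiv j L = 0 := (hLQ j).resolve_right hj
  rw [hLj, zero_mul, zero_add]
  have hjp : j ≠ p := by rintro rfl; exact hj hQp
  rcases eq_or_ne j q with rfl | hjq
  · simp only [hi, hj, if_true, if_false] at hij
    split_ifs at hij with hij'
    · rw [hij', hqq, mul_zero]
    · omega
  · rw [hQ j hjp hjq, mul_zero]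

/-- The traces of the Jacobian and its square make the Jacobian determinant of `Q p`, `Q q` in
`x_p`, `x_q` vanish. Forms of equal degree in two variables are then proportional, and a
transvection makes `Q p` zero. -/
theorem similarToTriangular_of_factor (h6 : (6 : K) ≠ 0) (hpq : p ≠ q) (hL0 : L ≠ 0)
    (hnil : IsNilpotent H.jacobian)
    (hH : ∀ i, H i = L * Q i) (hLp : pderiv p L = 0) (hLq : pderiv q L = 0)
    (hLQ : ∀ i, pderiv i L = 0 ∨ Q i = 0)
    (hQ : ∀ l, l ≠ p → l ≠ q → ∀ i, pderiv l (Q i) = 0)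
    {d : ℕ} (hd0 : d ≠ 0) (hd4 : d ≤ 4) (hhom : ∀ i, (Q i).IsHomogeneous d) :
    SimilarToTriangular H.jacobian := by
  classical
  have hs2 : ∀ g : Fin n → MvPolynomial (Fin n) K, (∀ i, i ≠ p → i ≠ q → g i = 0) →
      ∑ i, g i = g p + g q := fun g hg => by
    rw [← Finset.sum_pair hpq]
    refine (Finset.sum_subset (Finset.subset_univ _) fun i _ hi => hg i ?_ ?_).symm <;>
    · rintro rfl; simp at hi
  have htr : pderiv p (Q p) + pderiv q (Q q) = 0 := by
    have := trace_eq_zero hnil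
    rw [hs2] at this
    · rw [hH, hH, pderiv_mul, pderiv_mul, hLp, hLq] at this
      exact (mul_eq_zero.1 (show L * (pderiv p (Q p) + pderiv q (Q q)) = 0 by
        linear_combination this)).resolve_left hL0
    · intro i hip hiq
      rw [hH, pderiv_mul, hQ i hip hiq]
      rcases hLQ i with h | h <;> simp [h]
  have hsq : pderiv p (Q p) * pderiv p (Q p) + pderiv q (Q p) * pderiv p (Q q) +
      (pderiv p (Q q) * pderiv q (Q p) + pderiv q (Q q) * pderiv q (Q q)) = 0 := by
    have := trace_sq_eq_zero hnil
    have hz : ∀ i j, j ≠ p → j ≠ q → pderiv j (H i) * pderiv i (H j) = 0 := by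
      intro i j hjp hjq
      rw [hH i, hH j, pderiv_mul, hQ j hjp hjq]
      rcases hLQ j with h | h <;> simp [h]
    rw [hs2] at this
    · rw [hs2 _ (hz p), hs2 _ (hz q)] at this
      rw [hH, hH, pderiv_mul, pderiv_mul, pderiv_mul, pderiv_mul, hLp, hLq] at this
      refine mul_left_cancel₀ (mul_ne_zero hL0 hL0) ?_
      linear_combination this
    · intro i hip hiq
      exact Finset.sum_eq_zero fun j _ => by rw [mul_comm]; exact hz j i hip hiq
  have h2 : (2 : MvPolynomial (Fin n) K) ≠ 0 := by
    rw [← map_ofNat C 2]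
    simpa using (fun h => h6 (by linear_combination 3 * h) : (2 : K) ≠ 0)
  have hdet : pderiv p (Q p) * pderiv q (Q q) = pderiv q (Q p) * pderiv p (Q q) := by
    refine mul_left_cancel₀ h2 ?_
    linear_combination (pderiv p (Q p) + pderiv q (Q q)) * htr - hsq
  have hEuler : ∀ i, X p * pderiv p (Q i) + X q * pderiv q (Q i) = C (d : K) * Q i := by
    intro i
    have := (hhom i).sum_X_mul_pderiv
    rw [hs2 _ fun l hlp hlq => by rw [hQ l hlp hlq, mul_zero], nsmul_eq_mul] at this
    rw [this]; simp
  have hd : (C (d : K) : MvPolynomial (Fin n) K) ≠ 0 :=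
    (map_ne_zero_iff C (C_injective _ _)).2 (natCast_ne_zero_of_le_four h6 hd0 hd4)
  have hdeg : ∀ i, (Q i).totalDegree ≤ 4 := fun i => (hhom i).totalDegree_le.trans hd4
  by_cases hQq : Q q = 0
  · exact similarToTriangular_of_factor_aux hpq.symm hL0 hnil hH hLq hLp hLQ
      (fun l h h' => hQ l h' h) hQq
  -- Euler's formula in `x_p`, `x_q` rewrites the Wronskians as multiples of the vanishing
  -- determinant.
  obtain ⟨κ, hκ⟩ := eq_C_mul_of_wronskian_eq_zero h6 (hdeg p) (hdeg q) hQq fun k => by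
    refine mul_left_cancel₀ hd ?_
    rcases eq_or_ne k p with rfl | hkp
    · linear_combination -pderiv k (Q q) * hEuler k + pderiv k (Q k) * hEuler q - X q * hdet
    rcases eq_or_ne k q with rfl | hkq
    · linear_combination -pderiv k (Q k) * hEuler p + pderiv k (Q p) * hEuler k + X p * hdet
    rw [hQ k hkp hkq, hQ k hkp hkq]; ring
  let T := transvectionGL p q hpq κ
  refine similarToTriangular_of_conj T ?_
  refine similarToTriangular_of_factor_aux (p := p) (q := q) (L := bind₁ (linear T.1) L)
    (Q := conj T Q) hpq ?_ (isNilpotent_jacobian_conj T hnil) ?_ ?_ ?_ ?_ ?_ ?_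
  · exact fun h => hL0 (bind₁_linear_injective T (by rw [h, map_zero]))
  · intro i
    rw [conj_apply, conj_apply, Finset.mul_sum]
    refine Finset.sum_congr rfl fun k _ => ?_
    rw [hH, map_mul]; ring
  · rw [pderiv_transvectionGL_of_ne _ _ _ _ hpq, hLp, map_zero]
  · rw [pderiv_transvectionGL_self, hLp, hLq]; simp
  · intro i
    rcases eq_or_ne i q with rfl | hiq
    · left; rw [pderiv_transvectionGL_self, hLp, hLq]; simp
    rcases eq_or_ne i p with rfl | hip
    · left; rw [pderiv_transvectionGL_of_ne _ _ _ _ hpq, hLp, map_zero]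
    rcases hLQ i with h | h
    · left; rw [pderiv_transvectionGL_of_ne _ _ _ _ hiq, h, map_zero]
    · right; rw [conj_transvectionGL_of_ne _ _ _ _ _ hip, h, map_zero]
  · intro l hlp hlq i
    rcases eq_or_ne i p with rfl | hip
    · rw [conj_transvectionGL_self, pderiv_transvectionGL_of_ne _ _ _ _ hlq, map_sub,
        pderiv_C_mul, hQ l hlp hlq, hQ l hlp hlq]
      simp
    · rw [conj_transvectionGL_of_ne _ _ _ _ _ hip, pderiv_transvectionGL_of_ne _ _ _ _ hlq,
        hQ l hlp hlq, map_zero]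
  · rw [conj_transvectionGL_self, hκ, sub_self, map_zero]

end Parallel

end PolyMap

namespace PolyMap

/-! ### Components spanning dimension at least three: triangularization. -/

section LargeSpan

variable {K : Type*} [Field K] {n : ℕ}

/-- Once the gcd `G` is removed, the vanishing Wronskians make each `h a` divide its own derivative
along `s`, which by degree is zero. -/
theorem exists_gcd_factorization {H : PolyMap n K} (h0 : ∃ i, H i ≠ 0)
    {s : Set (Fin n)} (hpar : ∀ j ∈ s, ∀ a b, H a * pderiv j (H b) = H b * pderiv j (H a)) :
    ∃ (G : MvPolynomial (Fin n) K) (h : PolyMap n K), (∀ i, H i = G * h i) ∧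
      ∀ j ∈ s, ∀ i, pderiv j (h i) = 0 := by
  obtain ⟨i₀, hi₀⟩ := h0
  let _ : StrongNormalizationMonoid (MvPolynomial (Fin n) K) :=
    UniqueFactorizationMonoid.strongNormalizationMonoid
  let _ : NormalizedGCDMonoid (MvPolynomial (Fin n) K) :=
    UniqueFactorizationMonoid.toNormalizedGCDMonoid _
  obtain ⟨h, hh, h1⟩ := Finset.extract_gcd (s := Finset.univ) H ⟨i₀, Finset.mem_univ _⟩
  set G := Finset.univ.gcd H
  have hh' : ∀ i, H i = G * h i := fun i => hh i (Finset.mem_univ i)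
  have hG : G ≠ 0 := by
    intro hG
    exact hi₀ (by rw [hh', hG, zero_mul])
  refine ⟨G, h, hh', fun j hj a => pderiv_eq_zero_of_dvd ?_⟩
  have key : ∀ b, h a ∣ pderiv j (h a) * h b := fun b => by
    refine ⟨pderiv j (h b), mul_left_cancel₀ (mul_ne_zero hG hG) ?_⟩
    have := hpar j hj a b
    rw [hh' a, hh' b, pderiv_mul, pderiv_mul] at this
    linear_combination -this
  have h2 : h a ∣ Finset.univ.gcd fun b => pderiv j (h a) * h b :=
    Finset.dvd_gcd fun b _ => key b
  have h3 := h2.trans (Finset.gcd_mul_left' Finset.univ h _).dvd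
  rwa [h1, mul_one] at h3

theorem finrank_span_range_le {H : PolyMap n K} (s : Finset (MvPolynomial (Fin n) K))
    (h : ∀ i, H i ∈ Submodule.span K (s : Set (MvPolynomial (Fin n) K))) :
    Module.finrank K (Submodule.span K (Set.range H)) ≤ s.card := by
  refine le_trans (Submodule.finrank_mono ?_) (finrank_span_finset_le_card s)
  rw [Submodule.span_le]
  rintro _ ⟨i, rfl⟩
  exact h i

/-- Forms of degree `e` in two variables span at most `e + 1` dimensions, so a span of dimension
three forces `h` to have degree at least 2. -/
theorem exists_linear_factorization {H : PolyMap n K} (hH : ∀ i, (H i).IsHomogeneous 3)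
    (h3 : 3 ≤ Module.finrank K (Submodule.span K (Set.range H))) {p q : Fin n} (hpq : p ≠ q)
    (hpar : ∀ j, j ≠ p → j ≠ q → ∀ a b, H a * pderiv j (H b) = H b * pderiv j (H a)) :
    ∃ (G : MvPolynomial (Fin n) K) (h : PolyMap n K) (d : ℕ), (∀ i, H i = G * h i) ∧
      (∀ j, j ≠ p → j ≠ q → ∀ i, pderiv j (h i) = 0) ∧ d ≤ 1 ∧ G.IsHomogeneous d ∧ G ≠ 0 ∧
      ∀ i, (h i).IsHomogeneous (3 - d) := by
  classical
  have h0 : ∃ i, H i ≠ 0 := by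
    by_contra! h0
    have := finrank_span_range_le (H := H) ∅ fun i => by simp [h0]
    simp at this
    omega
  obtain ⟨G, h, hGh, hder⟩ := exists_gcd_factorization h0 (s := {j | j ≠ p ∧ j ≠ q})
    fun j hj => hpar j hj.1 hj.2
  obtain ⟨i₀, hi₀⟩ := h0
  have hG0 : G ≠ 0 := by
    intro hG
    exact hi₀ (by rw [hGh, hG, zero_mul])
  have hGhom : G.IsHomogeneous G.totalDegree :=
    isHomogeneous_of_mul (d := 3) (by rw [← hGh i₀]; exact hH i₀) (by rw [← hGh i₀]; exact hi₀)
  have hle : G.totalDegree ≤ 3 := by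
    have h1 : h i₀ ≠ 0 := fun h => hi₀ (by rw [hGh, h, mul_zero])
    have := (hH i₀).totalDegree hi₀
    rw [hGh, totalDegree_mul_of_isDomain hG0 h1] at this
    omega
  have hhom : ∀ i, (h i).IsHomogeneous (3 - G.totalDegree) := by
    intro i
    by_cases hi : h i = 0
    · rw [hi]; exact isHomogeneous_zero _ _ _
    have hHi : H i ≠ 0 := by rw [hGh]; exact mul_ne_zero hG0 hi
    have h1 := isHomogeneous_of_mul (f := h i) (g := G) (d := 3)
      (by rw [mul_comm, ← hGh i]; exact hH i) (by rw [mul_comm, ← hGh i]; exact hHi)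
    have h2 := (hH i).totalDegree hHi
    rw [hGh, totalDegree_mul_of_isDomain hG0 hi] at h2
    rwa [show 3 - G.totalDegree = (h i).totalDegree by omega]
  refine ⟨G, h, G.totalDegree, hGh, fun j hp hq => hder j ⟨hp, hq⟩, ?_, hGhom, hG0, hhom⟩
  by_contra hlt
  have hcases : G.totalDegree = 2 ∨ G.totalDegree = 3 := by omega
  rcases hcases with hd | hd
  · rw [hd] at hhom
    have := finrank_span_range_le (H := H) {G * X p, G * X q} fun i => by
      obtain ⟨a, ha, ha'⟩ := exists_eq_sum_of_isHomogeneous_one (hhom i)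
      have hz : ∀ k, k ≠ p → k ≠ q → a k = 0 := fun k hp hq => by
        have := ha' k
        rw [hder k ⟨hp, hq⟩] at this
        simpa using this.symm
      have hsum : h i = C (a p) * X p + C (a q) * X q := by
        rw [ha, ← Finset.sum_pair (f := fun k => C (a k) * X k) hpq]
        refine (Finset.sum_subset (Finset.subset_univ _) fun k _ hk => ?_).symm
        rw [hz k (by rintro rfl; simp at hk) (by rintro rfl; simp at hk)]
        simp
      rw [hGh, hsum, show G * (C (a p) * X p + C (a q) * X q) =
        a p • (G * X p) + a q • (G * X q) by simp only [smul_eq_C_mul]; ring]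
      exact add_mem (Submodule.smul_mem _ _ (Submodule.subset_span (by simp)))
        (Submodule.smul_mem _ _ (Submodule.subset_span (by simp)))
    have := this.trans Finset.card_le_two
    omega
  · rw [hd] at hhom
    have := finrank_span_range_le (H := H) {G} fun i => by
      have h1 := (totalDegree_zero_iff_isHomogeneous _).2 (hhom i)
      rw [totalDegree_eq_zero_iff_eq_C] at h1
      rw [hGh, h1, mul_comm, ← smul_eq_C_mul]
      exact Submodule.smul_mem _ _ (Submodule.subset_span (by simp))
    rw [Finset.card_singleton] at this
    omega

/-- The trace is `Q r + X r * ∑ ∂ᵢ(Q i)`, and `Q` is free of `x_r`. Its vanishing therefore gives `Q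
r = 0`, as required to apply `similarToTriangular_of_factor` with `L = X r`. -/
theorem similarToTriangular_of_X_mul (h6 : (6 : K) ≠ 0) {H Q : PolyMap n K} {p q r : Fin n}
    (hpq : p ≠ q) (hpr : p ≠ r) (hqr : q ≠ r) (hnil : IsNilpotent H.jacobian)
    (hH : ∀ i, H i = X r * Q i) (hQ : ∀ l, l ≠ p → l ≠ q → ∀ i, pderiv l (Q i) = 0)
    (hhom : ∀ i, (Q i).IsHomogeneous 2) : SimilarToTriangular H.jacobian := by
  have hQr : Q r = 0 := by
    have h1 := congrArg (pderiv r) (trace_eq_zero hnil)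
    rw [map_sum, map_zero] at h1
    have h2 : ∀ i, pderiv r (pderiv i (H i)) = pderiv i (Q i) := by
      intro i
      have hc := pderiv_comm r i (Q i)
      rw [hQ r hpr.symm hqr.symm i, map_zero] at hc
      rw [hH, pderiv_mul, map_add, pderiv_mul, pderiv_mul, hc, hQ r hpr.symm hqr.symm]
      rcases eq_or_ne i r with rfl | hir
      · simp [hQ i hpr.symm hqr.symm]
      · simp [pderiv_X_of_ne hir.symm]
    simp only [h2] at h1
    have h3 : ∑ i, pderiv i (H i) = Q r + X r * ∑ i, pderiv i (Q i) := by
      rw [Finset.mul_sum]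
      simp only [hH, pderiv_mul, Finset.sum_add_distrib, pderiv_X, Pi.single_apply]
      simp
    rw [trace_eq_zero hnil, h1] at h3
    simpa using h3.symm
  refine similarToTriangular_of_factor h6 (p := p) (q := q) (L := X r) hpq (X_ne_zero r) hnil hH
    (pderiv_X_of_ne hpr.symm) (pderiv_X_of_ne hqr.symm) (fun i => ?_) hQ (d := 2) (by norm_num)
    (by norm_num) hhom
  rcases eq_or_ne i r with rfl | hir
  · exact Or.inr hQr
  · exact Or.inl (pderiv_X_of_ne hir.symm)

theorem bind₁_linear_of_linear (A : Matrix (Fin n) (Fin n) K) (g : Fin n → K) :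
    bind₁ (linear A) (∑ k, C (g k) * X k) = ∑ l, C (∑ k, g k * A k l) * X l := by
  simp only [map_sum, map_mul, bind₁_C_right, bind₁_X_right, linear, Finset.mul_sum,
    Finset.sum_mul]
  rw [Finset.sum_comm]
  exact Finset.sum_congr rfl fun _ _ => Finset.sum_congr rfl fun _ _ => by ring

theorem similarToTriangular_of_linear_mul (h6 : (6 : K) ≠ 0) {H h : PolyMap n K} {g : Fin n → K}
    (hn : 2 < n) {r : Fin n} (hr : 2 ≤ r.val) (hg : g r ≠ 0) (hnil : IsNilpotent H.jacobian)
    (hH : ∀ i, H i = (∑ k, C (g k) * X k) * h i)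
    (hder : ∀ j : Fin n, 2 ≤ j.val → ∀ i, pderiv j (h i) = 0)
    (hhom : ∀ i, (h i).IsHomogeneous 2) : SimilarToTriangular H.jacobian := by
  classical
  set p : Fin n := ⟨0, by omega⟩ with hp
  set q : Fin n := ⟨1, by omega⟩ with hq
  set t : Fin n := ⟨2, hn⟩ with ht
  have hpq : p ≠ q := by simp [hp, hq]
  have hpt : p ≠ t := by simp [hp, ht]
  have hqt : q ≠ t := by simp [hq, ht]
  have hrp : r ≠ p := fun h => by rw [h, hp] at hr; simp at hr
  have hrq : r ≠ q := fun h => by rw [h, hq] at hr; simp at hr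
  have hge : ∀ l : Fin n, l ≠ p → l ≠ q → 2 ≤ l.val := by
    intro l hlp hlq
    have h1 : l.val ≠ 0 := fun h => hlp (Fin.ext h)
    have h2 : l.val ≠ 1 := fun h => hlq (Fin.ext h)
    omega
  let γ : (Fin n → K) →ₗ[K] K := Fintype.linearCombination K g
  have hγ : ∀ v, γ v = ∑ k, v k * g k := fun v => by
    simp [γ, Fintype.linearCombination_apply]
  have hγs : ∀ k, γ (Pi.single k 1) = g k := fun k => by
    simp [hγ, Pi.single_apply]
  let N : Submodule K (Fin n → K) :=
    LinearMap.ker γ ⊓ (LinearMap.ker (LinearMap.proj (R := K) (φ := fun _ : Fin n => K) p) ⊓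
      LinearMap.ker (LinearMap.proj (R := K) (φ := fun _ : Fin n => K) q))
  have hN : ∀ v, v ∈ N ↔ γ v = 0 ∧ v p = 0 ∧ v q = 0 := fun v => by
    simp [N, Submodule.mem_inf]
  -- This is the basis dual to `x_p`, `x_q` and the linear form with coefficients `g`. The
  -- substitution turns that form into the third variable while keeping `x_p` and `x_q`.
  let u : Fin 3 → Fin n → K := ![Pi.single p 1 - (g p / g r) • Pi.single r 1,
    Pi.single q 1 - (g q / g r) • Pi.single r 1, (1 / g r) • Pi.single r 1]
  have u0p : u 0 p = 1 := by simp [u, hrp.symm]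
  have u0q : u 0 q = 0 := by simp [u, hrq.symm, hpq.symm]
  have u1p : u 1 p = 0 := by simp [u, hrp.symm, hpq]
  have u1q : u 1 q = 1 := by simp [u, hrq.symm]
  have u2p : u 2 p = 0 := by simp [u, hrp.symm]
  have u2q : u 2 q = 0 := by simp [u, hrq.symm]
  have γ0 : γ (u 0) = 0 := by
    simp only [u, Matrix.cons_val_zero, map_sub, map_smul, hγs, smul_eq_mul]
    field_simp; ring
  have γ1 : γ (u 1) = 0 := by
    simp only [u, Matrix.cons_val_one, Matrix.cons_val_zero, map_sub, map_smul, hγs, smul_eq_mul]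
    field_simp; ring
  have γ2 : γ (u 2) = 1 := by
    simp only [u, Matrix.cons_val, map_smul, hγs, smul_eq_mul]
    field_simp
  have huli : LinearIndependent K u := by
    rw [Fintype.linearIndependent_iff]
    intro c hc
    rw [Fin.sum_univ_three] at hc
    have c0 := congrFun hc p
    have c1 := congrFun hc q
    have c2 := congrArg γ hc
    simp [u0p, u1p, u2p] at c0
    simp [u0q, u1q, u2q] at c1
    simp [γ0, γ1, γ2] at c2
    intro i
    fin_cases i <;> assumption
  have hspan : Submodule.span K (Set.range u) ⊔ N = ⊤ := by
    rw [eq_top_iff]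
    intro v _
    have hv : v = (v p • u 0 + v q • u 1 + γ v • u 2) +
        (v - (v p • u 0 + v q • u 1 + γ v • u 2)) := by abel
    rw [hv]
    have hu : ∀ i, u i ∈ Submodule.span K (Set.range u) := fun i =>
      Submodule.subset_span ⟨i, rfl⟩
    refine Submodule.add_mem_sup (add_mem (add_mem (Submodule.smul_mem _ _ (hu 0))
      (Submodule.smul_mem _ _ (hu 1))) (Submodule.smul_mem _ _ (hu 2))) ((hN _).2 ⟨?_, ?_, ?_⟩)
    · simp [γ0, γ1, γ2]
    · simp [u0p, u1p, u2p]
    · simp [u0q, u1q, u2q]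
  obtain ⟨hk, T, hTu, hTN⟩ := exists_GL_extending u huli N hspan
  have T0 : (fun a => T.1 a p) = u 0 := hTu 0
  have T1 : (fun a => T.1 a q) = u 1 := hTu 1
  have T2 : (fun a => T.1 a t) = u 2 := hTu 2
  have hcol : ∀ l, l ≠ p → l ≠ q → T.1 p l = 0 ∧ T.1 q l = 0 := by
    intro l hlp hlq
    have h2 := hge l hlp hlq
    rcases eq_or_ne l t with rfl | hlt
    · exact ⟨(congrFun T2 p).trans u2p, (congrFun T2 q).trans u2q⟩
    · have h3 : l.val ≠ 2 := fun h => hlt (Fin.ext h)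
      have := (hN _).1 (hTN l (by omega))
      exact this.2
  have hγcol : ∀ l, γ (fun a => T.1 a l) = if l = t then 1 else 0 := by
    intro l
    rcases eq_or_ne l p with rfl | hlp
    · rw [T0, γ0, if_neg hpt]
    rcases eq_or_ne l q with rfl | hlq
    · rw [T1, γ1, if_neg hqt]
    rcases eq_or_ne l t with rfl | hlt
    · rw [T2, γ2, if_pos rfl]
    · have h2 := hge l hlp hlq
      have h3 : l.val ≠ 2 := fun h => hlt (Fin.ext h)
      rw [((hN _).1 (hTN l (by omega))).1, if_neg hlt]
  have hGT : bind₁ (linear T.1) (∑ k, C (g k) * X k) = X t := by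
    rw [bind₁_linear_of_linear]
    have : ∀ l, ∑ k, g k * T.1 k l = if l = t then 1 else 0 := fun l => by
      rw [← hγcol l, hγ]
      exact Finset.sum_congr rfl fun _ _ => mul_comm _ _
    simp [this, apply_ite]
  refine similarToTriangular_of_conj T ?_
  refine similarToTriangular_of_X_mul h6 (Q := conj T h) hpq hpt hqt
    (isNilpotent_jacobian_conj T hnil) (fun i => ?_) (fun l hlp hlq i => ?_)
    (isHomogeneous_conj T hhom)
  · rw [conj_apply, conj_apply, Finset.mul_sum]
    refine Finset.sum_congr rfl fun k _ => ?_
    rw [hH, map_mul, hGT]; ring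
  · rw [pderiv_conj]
    refine Finset.sum_eq_zero fun k _ => ?_
    rw [dirDeriv_apply, Finset.sum_eq_zero, map_zero, mul_zero]
    intro m _
    rcases eq_or_ne m p with rfl | hmp
    · simp [(hcol l hlp hlq).1]
    rcases eq_or_ne m q with rfl | hmq
    · simp [(hcol l hlp hlq).2]
    rw [hder m (hge m hmp hmq), mul_zero]

/-- Either `G` involves a variable beyond the first two, and is then a linear form that can be made
a coordinate, or all of `H` lives in the first two variables. -/
theorem similarToTriangular_of_three_le (h6 : (6 : K) ≠ 0) {H : PolyMap n K}
    (hH : ∀ i, (H i).IsHomogeneous 3) (hnil : IsNilpotent H.jacobian)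
    (h3 : 3 ≤ Module.finrank K (Submodule.span K (Set.range H)))
    (hpar : ∀ j : Fin n, 2 ≤ j.val → ∀ a b, H a * pderiv j (H b) = H b * pderiv j (H a)) :
    SimilarToTriangular H.jacobian := by
  have hn : 2 < n := by
    have := h3.trans (finrank_range_le_card H)
    exact Nat.lt_of_succ_le (by simpa using this)
  set p : Fin n := ⟨0, by omega⟩ with hp
  set q : Fin n := ⟨1, by omega⟩ with hq
  have hpq : p ≠ q := by simp [hp, hq]
  have hge : ∀ l : Fin n, l ≠ p → l ≠ q → 2 ≤ l.val := by
    intro l hlp hlq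
    have h1 : l.val ≠ 0 := fun h => hlp (Fin.ext h)
    have h2 : l.val ≠ 1 := fun h => hlq (Fin.ext h)
    omega
  obtain ⟨G, h, d, hGh, hder, hd, hGhom, hG0, hhom⟩ := exists_linear_factorization hH h3 hpq
    fun j hjp hjq => hpar j (hge j hjp hjq)
  by_cases hG : ∃ r : Fin n, 2 ≤ r.val ∧ pderiv r G ≠ 0
  · obtain ⟨r, hr, hGr⟩ := hG
    have hd1 : d = 1 := by
      by_contra hne
      have hd0 : d = 0 := by omega
      rw [hd0, ← totalDegree_zero_iff_isHomogeneous, totalDegree_eq_zero_iff_eq_C] at hGhom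
      exact hGr (by rw [hGhom, pderiv_C])
    subst hd1
    obtain ⟨g, hg, hg'⟩ := exists_eq_sum_of_isHomogeneous_one hGhom
    refine similarToTriangular_of_linear_mul h6 hn hr (g := g) (h := h) ?_ hnil
      (fun i => by rw [hGh i, ← hg]) (fun j hj i => hder j ?_ ?_ i) hhom
    · intro h; exact hGr (by rw [hg', h, map_zero])
    · rintro rfl; simp [hp] at hj
    · rintro rfl; simp [hq] at hj
  · push Not at hG
    refine similarToTriangular_of_factor h6 (p := p) (q := q) (L := 1) (Q := H) hpq one_ne_zero
      hnil (fun i => (one_mul _).symm) pderiv_one pderiv_one (fun i => Or.inl pderiv_one)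
      (fun l hlp hlq i => ?_) (d := 3) (by norm_num) (by norm_num) hH
    rw [hGh, pderiv_mul, hG l (hge l hlp hlq), hder l hlp hlq]
    simp

end LargeSpan

end PolyMap

namespace PolyMap

/-! ### Two nonzero components: the normal form and its coordinates. -/

section SmallSpan

variable {K : Type*} [Field K] {n : ℕ}

/-- The normal form of a nilpotent cubic homogeneous map with Jacobian rank two that is not
triangularizable. -/
def IsNormalForm (H : PolyMap n K) : Prop :=
  ∃ i₀ i₁ i₂ i₃ : Fin n, i₀.val = 0 ∧ i₁.val = 1 ∧ i₂.val = 2 ∧ i₃.val = 3 ∧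
    H i₀ - (X i₀ * X i₂ * X i₃ - X i₁ * X i₃ ^ 2) ∈ supported K {j : Fin n | 2 ≤ j.val} ∧
    H i₁ - (X i₀ * X i₂ ^ 2 - X i₁ * X i₂ * X i₃) ∈ supported K {j : Fin n | 2 ≤ j.val} ∧
    ∀ i : Fin n, 2 ≤ i.val → H i = 0

theorem similarToTriangular_of_diag {H : PolyMap n K} {p q : Fin n} (hpq : p ≠ q)
    (hH : ∀ i, i ≠ p → i ≠ q → H i = 0) (hp : pderiv p (H p) = 0) (hq : pderiv q (H q) = 0)
    (hqp : pderiv p (H q) = 0) : SimilarToTriangular H.jacobian := by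
  refine similarToTriangular_of_height (fun i => if i = p then 2 else if i = q then 1 else 0)
    fun i j hij => ?_
  rcases eq_or_ne i p with rfl | hip
  · rcases eq_or_ne j i with rfl | hji
    · exact hp
    · simp only [if_true, hji, if_false] at hij
      split_ifs at hij <;> omega
  rcases eq_or_ne i q with rfl | hiq
  · rcases eq_or_ne j p with rfl | hjp
    · exact hqp
    rcases eq_or_ne j i with rfl | hji
    · exact hq
    · simp [hpq.symm, hjp, hji] at hij
  rw [hH i hip hiq, map_zero]

theorem trace_pair {H : PolyMap n K} {p q : Fin n} (hpq : p ≠ q)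
    (hH : ∀ i, i ≠ p → i ≠ q → H i = 0) (hnil : IsNilpotent H.jacobian) :
    pderiv p (H p) + pderiv q (H q) = 0 := by
  classical
  have := trace_eq_zero hnil
  rw [← this, ← Finset.sum_pair (f := fun i => pderiv i (H i)) hpq]
  refine Finset.sum_subset (Finset.subset_univ _) fun i _ hi => ?_
  simp only [Finset.mem_insert, Finset.mem_singleton, not_or] at hi
  rw [hH i hi.1 hi.2, map_zero]

theorem trace_sq_pair {H : PolyMap n K} {p q : Fin n} (hpq : p ≠ q)
    (hH : ∀ i, i ≠ p → i ≠ q → H i = 0) (hnil : IsNilpotent H.jacobian) :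
    pderiv p (H p) * pderiv p (H p) + pderiv q (H p) * pderiv p (H q) +
      (pderiv p (H q) * pderiv q (H p) + pderiv q (H q) * pderiv q (H q)) = 0 := by
  classical
  have hs2 : ∀ g : Fin n → MvPolynomial (Fin n) K, (∀ i, i ≠ p → i ≠ q → g i = 0) →
      ∑ i, g i = g p + g q := fun g hg => by
    rw [← Finset.sum_pair hpq]
    refine (Finset.sum_subset (Finset.subset_univ _) fun i _ hi => hg i ?_ ?_).symm <;>
    · rintro rfl; simp at hi
  have := trace_sq_eq_zero hnil
  rw [hs2 _ fun i hp hq => Finset.sum_eq_zero fun j _ => by simp [hH i hp hq],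
    hs2 _ fun i hp hq => by simp [hH i hp hq], hs2 _ fun i hp hq => by simp [hH i hp hq]] at this
  exact this

/-- The normal form is reached if the nonzero block of the Jacobian is built from two independent
linear forms not involving the first two variables. -/
theorem exists_conj_isNormalForm {H : PolyMap n K} (hH : ∀ i, (H i).IsHomogeneous 3)
    {p q : Fin n} (hp : p.val = 0) (hq : q.val = 1)
    (hz : ∀ i, i ≠ p → i ≠ q → H i = 0) {κ : K} (hκ : κ ≠ 0) {α β : Fin n → K}
    (hαp : α p = 0) (hαq : α q = 0) (hβp : β p = 0) (hβq : β q = 0)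
    {k l : Fin n} (hΔ : α k * β l - α l * β k ≠ 0)
    (hpp : pderiv p (H p) = C κ * (∑ i, C (α i) * X i) * ∑ i, C (β i) * X i)
    (hqp : pderiv q (H p) = C κ * (∑ i, C (β i) * X i) ^ 2)
    (hpq : pderiv p (H q) = -(C κ * (∑ i, C (α i) * X i) ^ 2))
    (hqq : pderiv q (H q) = -(C κ * (∑ i, C (α i) * X i) * ∑ i, C (β i) * X i))
    (h6 : (6 : K) ≠ 0) :
    ∃ T : Matrix.GeneralLinearGroup (Fin n) K, IsNormalForm (conj T H) := by
  classical
  have hne : p ≠ q := fun h => by rw [h, hq] at hp; omega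
  let A : (Fin n → K) →ₗ[K] K := Fintype.linearCombination K α
  let B : (Fin n → K) →ₗ[K] K := Fintype.linearCombination K β
  have hA : ∀ v, A v = ∑ k, v k * α k := fun v => by simp [A, Fintype.linearCombination_apply]
  have hB : ∀ v, B v = ∑ k, v k * β k := fun v => by simp [B, Fintype.linearCombination_apply]
  have hAs : ∀ k, A (Pi.single k 1) = α k := fun k => by simp [hA, Pi.single_apply]
  have hBs : ∀ k, B (Pi.single k 1) = β k := fun k => by simp [hB, Pi.single_apply]
  set Δ := α k * β l - α l * β k with hΔdef
  -- Cramer's rule: the values of `(A, B)` are to be `(1, 0)` on `w₂` and `(0, κ⁻¹)` on `w₃`.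
  let w₂ : Fin n → K := (β l / Δ) • Pi.single k 1 - (β k / Δ) • Pi.single l 1
  let w₃ : Fin n → K := (α k / (Δ * κ)) • Pi.single l 1 - (α l / (Δ * κ)) • Pi.single k 1
  have A2 : A w₂ = 1 := by
    simp only [w₂, map_sub, map_smul, hAs, smul_eq_mul]
    field_simp
    rw [hΔdef]; ring
  have B2 : B w₂ = 0 := by
    simp only [w₂, map_sub, map_smul, hBs, smul_eq_mul]
    ring
  have A3 : A w₃ = 0 := by
    simp only [w₃, map_sub, map_smul, hAs, smul_eq_mul]
    ring
  have B3 : B w₃ = κ⁻¹ := by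
    simp only [w₃, map_sub, map_smul, hBs, smul_eq_mul]
    field_simp
    rw [hΔdef]
  have hρ : -κ⁻¹ ≠ 0 := neg_ne_zero.2 (inv_ne_zero hκ)
  -- The scaling by `-κ⁻¹`, together with `B w₃ = κ⁻¹`, removes `κ` from all four entries of the
  -- block and produces the signs of the normal form.
  let u : Fin 4 → Fin n → K := ![(-κ⁻¹) • Pi.single p 1, Pi.single q 1, w₂, w₃]
  have hu0 : u 0 = (-κ⁻¹) • Pi.single p 1 := rfl
  have hu1 : u 1 = Pi.single q 1 := rfl
  have hu2 : u 2 = w₂ := rfl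
  have hu3 : u 3 = w₃ := rfl
  have huli : LinearIndependent K u := by
    rw [Fintype.linearIndependent_iff]
    intro c hc
    rw [Fin.sum_univ_four, hu0, hu1, hu2, hu3] at hc
    have c2 := congrArg A hc
    have c3 := congrArg B hc
    simp only [map_add, map_smul, hAs, A2, A3, hαp, hαq, smul_eq_mul, mul_zero, mul_one,
      zero_add, add_zero, map_zero] at c2
    simp only [map_add, map_smul, hBs, B2, B3, hβp, hβq, smul_eq_mul, mul_zero,
      zero_add, add_zero, map_zero] at c3
    have c3' : c 3 = 0 := (mul_eq_zero.1 c3).resolve_right (inv_ne_zero hκ)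
    rw [c2, c3', zero_smul, zero_smul, add_zero, add_zero] at hc
    have c0 := congrFun hc p
    have c1 := congrFun hc q
    simp [hne, hκ] at c0
    simp [hne.symm] at c1
    intro i
    fin_cases i <;> assumption
  have hspan : Submodule.span K (Set.range u) ⊔ (LinearMap.ker A ⊓ LinearMap.ker B) = ⊤ := by
    rw [eq_top_iff]
    intro v _
    have hv : v = (A v • u 2 + (κ * B v) • u 3) + (v - (A v • u 2 + (κ * B v) • u 3)) := by abel
    rw [hv]
    have hu : ∀ i, u i ∈ Submodule.span K (Set.range u) := fun i =>
      Submodule.subset_span ⟨i, rfl⟩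
    refine Submodule.add_mem_sup (add_mem (Submodule.smul_mem _ _ (hu 2))
      (Submodule.smul_mem _ _ (hu 3))) (Submodule.mem_inf.2 ⟨?_, ?_⟩)
    · rw [LinearMap.mem_ker, hu2, hu3]
      simp [A2, A3]
    · rw [LinearMap.mem_ker, hu2, hu3]
      simp only [map_sub, map_add, map_smul, B2, B3, smul_eq_mul]
      field_simp
      ring
  obtain ⟨hn, T, hTu, hTN⟩ := exists_GL_extending u huli _ hspan
  have hpe : (⟨0, by omega⟩ : Fin n) = p := Fin.ext hp.symm
  have hqe : (⟨1, by omega⟩ : Fin n) = q := Fin.ext hq.symm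
  set t₂ : Fin n := ⟨2, by omega⟩ with ht₂
  set t₃ : Fin n := ⟨3, by omega⟩ with ht₃
  have hp2 : p ≠ t₂ := fun h => by simp [h, ht₂] at hp
  have hp3 : p ≠ t₃ := fun h => by simp [h, ht₃] at hp
  have hq2 : q ≠ t₂ := fun h => by simp [h, ht₂] at hq
  have hq3 : q ≠ t₃ := fun h => by simp [h, ht₃] at hq
  have h23 : t₂ ≠ t₃ := by simp [ht₂, ht₃]
  have T0 : (fun a => T.1 a p) = (-κ⁻¹) • Pi.single p 1 := by
    rw [← hu0, ← hTu 0, ← hpe]; rfl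
  have T1 : (fun a => T.1 a q) = Pi.single q 1 := by
    rw [← hu1, ← hTu 1, ← hqe]; rfl
  have T2 : (fun a => T.1 a t₂) = w₂ := hTu 2
  have T3 : (fun a => T.1 a t₃) = w₃ := hTu 3
  have hcols : ∀ j, A (fun a => T.1 a j) = (if j = t₂ then 1 else 0) ∧
      B (fun a => T.1 a j) = if j = t₃ then κ⁻¹ else 0 := by
    intro j
    rcases eq_or_ne j p with hj | hj0
    · rw [hj, T0, if_neg hp2, if_neg hp3, map_smul, map_smul, hAs, hBs, hαp, hβp]; simp
    rcases eq_or_ne j q with hj | hj1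
    · rw [hj, T1, if_neg hq2, if_neg hq3, hAs, hBs, hαq, hβq]; simp
    rcases eq_or_ne j t₂ with hj | hj2
    · rw [hj, T2, if_pos rfl, if_neg h23, A2, B2]; simp
    rcases eq_or_ne j t₃ with hj | hj3
    · rw [hj, T3, if_pos rfl, if_neg h23.symm, A3, B3]; simp
    rw [if_neg hj2, if_neg hj3]
    have h0 : j.val ≠ 0 := fun h => hj0 (Fin.ext (h.trans hp.symm))
    have h1 : j.val ≠ 1 := fun h => hj1 (Fin.ext (h.trans hq.symm))
    have h2 : j.val ≠ 2 := fun h => hj2 (Fin.ext h)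
    have h3 : j.val ≠ 3 := fun h => hj3 (Fin.ext h)
    exact Submodule.mem_inf.1 (hTN j (by omega))
  have bA : bind₁ (linear T.1) (∑ i, C (α i) * X i) = X t₂ := by
    rw [bind₁_linear_of_linear]
    have : ∀ l, ∑ k, α k * T.1 k l = if l = t₂ then 1 else 0 := fun l => by
      rw [← (hcols l).1, hA]
      exact Finset.sum_congr rfl fun _ _ => mul_comm _ _
    simp [this, apply_ite]
  have bB : bind₁ (linear T.1) (∑ i, C (β i) * X i) = C κ⁻¹ * X t₃ := by
    rw [bind₁_linear_of_linear]
    have : ∀ l, ∑ k, β k * T.1 k l = if l = t₃ then κ⁻¹ else 0 := fun l => by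
      rw [← (hcols l).2, hB]
      exact Finset.sum_congr rfl fun _ _ => mul_comm _ _
    simp [this, apply_ite]
  have hinv : (T⁻¹).1 * T.1 = 1 := by rw [← Units.val_mul, inv_mul_cancel, Units.val_one]
  have Sp : ∀ i, (T⁻¹).1 i p = if i = p then -κ else 0 := by
    intro i
    have := congrFun (congrFun hinv i) p
    rw [Matrix.mul_apply, Finset.sum_eq_single p, Matrix.one_apply, congrFun T0 p] at this
    · simp only [Pi.smul_apply, Pi.single_eq_same, smul_eq_mul, mul_one] at this
      split_ifs at this ⊢
      · linear_combination -κ * this - (T⁻¹).1 i p * mul_inv_cancel₀ hκ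
      · exact (mul_eq_zero.1 this).resolve_right hρ
    · intro b _ hb
      rw [congrFun T0 b]; simp [hb]
    · simp
  have Sq : ∀ i, (T⁻¹).1 i q = if i = q then 1 else 0 := by
    intro i
    have := congrFun (congrFun hinv i) q
    rw [Matrix.mul_apply, Finset.sum_eq_single q, Matrix.one_apply, congrFun T1 q] at this
    · simpa using this
    · intro b _ hb
      rw [congrFun T1 b]; simp [hb]
    · simp
  have hconj : ∀ i, conj T H i = C ((T⁻¹).1 i p) * bind₁ (linear T.1) (H p) +
      C ((T⁻¹).1 i q) * bind₁ (linear T.1) (H q) := by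
    intro i
    rw [conj_apply, ← Finset.sum_pair (f := fun k => C ((T⁻¹).1 i k) * bind₁ (linear T.1) (H k)) hne]
    refine (Finset.sum_subset (Finset.subset_univ _) fun k _ hk => ?_).symm
    simp only [Finset.mem_insert, Finset.mem_singleton, not_or] at hk
    rw [hz k hk.1 hk.2]; simp
  have conjp : conj T H p = C (-κ) * bind₁ (linear T.1) (H p) := by
    rw [hconj, Sp, Sq, if_pos rfl, if_neg hne]; simp
  have conjq : conj T H q = bind₁ (linear T.1) (H q) := by
    rw [hconj, Sp, Sq, if_pos rfl, if_neg hne.symm]; simp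
  have dp : ∀ v, pderiv p (bind₁ (linear T.1) v) = C (-κ⁻¹) * bind₁ (linear T.1) (pderiv p v) := by
    intro v
    rw [pderiv_bind₁_linear, T0, dirDeriv_smul, dirDeriv_single, map_mul, bind₁_C_right]
  have dq : ∀ v, pderiv q (bind₁ (linear T.1) v) = bind₁ (linear T.1) (pderiv q v) := by
    intro v
    rw [pderiv_bind₁_linear, T1, dirDeriv_single]
  have hCC : (C κ : MvPolynomial (Fin n) K) * C κ⁻¹ = 1 := by
    rw [← C_mul, mul_inv_cancel₀ hκ, C_1]
  have hhom : ∀ a b c : Fin n, (X a * X b * X c : MvPolynomial (Fin n) K).IsHomogeneous 3 :=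
    fun a b c => ((isHomogeneous_X K a).mul (isHomogeneous_X K b)).mul (isHomogeneous_X K c)
  have hsupp : ∀ w : MvPolynomial (Fin n) K, w.IsHomogeneous 3 → pderiv p w = 0 →
      pderiv q w = 0 → w ∈ supported K {j : Fin n | 2 ≤ j.val} := by
    intro w hw hwp hwq
    refine mem_supported_of_pderiv_eq_zero h6 (hw.totalDegree_le.trans (by norm_num))
      fun j hj => ?_
    have hj' : ¬ 2 ≤ j.val := hj
    rcases (by omega : j.val = 0 ∨ j.val = 1) with h | h
    · rwa [show j = p from Fin.ext (h.trans hp.symm)]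
    · rwa [show j = q from Fin.ext (h.trans hq.symm)]
  refine ⟨T, p, q, t₂, t₃, hp, hq, rfl, rfl, hsupp _ ?_ ?_ ?_, hsupp _ ?_ ?_ ?_, fun i hi => ?_⟩
  · refine (isHomogeneous_conj T hH _).sub ((hhom _ _ _).sub ?_)
    rw [sq, ← mul_assoc]; exact hhom _ _ _
  · rw [conjp]
    simp only [map_sub, pderiv_mul, pderiv_C, pderiv_pow, dp, hpp, map_mul, bind₁_C_right, bA, bB,
      pderiv_X_self, pderiv_X_of_ne hne.symm, pderiv_X_of_ne hp2.symm, pderiv_X_of_ne hp3.symm,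
      map_neg]
    linear_combination (C κ * C κ⁻¹ + 1) * X t₂ * X t₃ * hCC
  · rw [conjp]
    simp only [map_sub, pderiv_mul, pderiv_C, pderiv_pow, dq, hqp, map_mul, map_pow,
      bind₁_C_right, bB,
      pderiv_X_self, pderiv_X_of_ne hne, pderiv_X_of_ne hq2.symm, pderiv_X_of_ne hq3.symm,
      map_neg]
    linear_combination -(C κ * C κ⁻¹ + 1) * X t₃ ^ 2 * hCC
  · refine (isHomogeneous_conj T hH _).sub (IsHomogeneous.sub ?_ (hhom _ _ _))
    rw [sq, ← mul_assoc]; exact hhom _ _ _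
  · rw [conjq]
    simp only [map_sub, pderiv_mul, pderiv_pow, dp, hpq, map_mul, map_pow, map_neg,
      bind₁_C_right, bA,
      pderiv_X_self, pderiv_X_of_ne hne.symm, pderiv_X_of_ne hp2.symm, pderiv_X_of_ne hp3.symm]
    linear_combination X t₂ ^ 2 * hCC
  · rw [conjq]
    simp only [map_sub, pderiv_mul, pderiv_pow, dq, hqq, map_mul, map_neg, bind₁_C_right, bA, bB,
      pderiv_X_self, pderiv_X_of_ne hne, pderiv_X_of_ne hq2.symm, pderiv_X_of_ne hq3.symm]
    linear_combination -X t₂ * X t₃ * hCC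
  · have hip : i ≠ p := fun h => by rw [h] at hi; omega
    have hiq : i ≠ q := fun h => by rw [h] at hi; omega
    rw [hconj, Sp, Sq, if_neg hip, if_neg hiq]; simp

end SmallSpan

end PolyMap

namespace PolyMap

/-! ### Two nonzero components: factoring the Jacobian block, and the dichotomy. -/

section SmallSpan

variable {K : Type*} [Field K] {n : ℕ}

/-- Columns proportional over `K` let a transvection clear the column of `p`; the trace condition
then clears the remaining diagonal entry. -/
theorem similarToTriangular_of_proportional {H : PolyMap n K} {p q : Fin n} (hpq : p ≠ q)
    (hH : ∀ i, i ≠ p → i ≠ q → H i = 0) (hnil : IsNilpotent H.jacobian) {κ : K}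
    (hp : pderiv p (H p) = C κ * pderiv q (H p)) (hq : pderiv p (H q) = C κ * pderiv q (H q)) :
    SimilarToTriangular H.jacobian := by
  let T := transvectionGL q p hpq.symm (-κ)
  have hTne : ∀ i, i ≠ q → conj T H i = bind₁ (linear T.1) (H i) := fun i hi =>
    conj_transvectionGL_of_ne _ _ _ _ _ hi
  have hTd : ∀ u, pderiv p (bind₁ (linear T.1) u) =
      bind₁ (linear T.1) (pderiv p u + C (-κ) * pderiv q u) := pderiv_transvectionGL_self _ _ _ _
  have hTq : conj T H q = bind₁ (linear T.1) (H q - C (-κ) * H p) := conj_transvectionGL_self _ _ _ _ _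
  have h1 : ∀ i, i ≠ p → i ≠ q → conj T H i = 0 := fun i hip hiq => by
    rw [hTne i hiq, hH i hip hiq, map_zero]
  have h2 : pderiv p (conj T H p) = 0 := by
    rw [hTne p hpq, hTd, hp, C_neg, neg_mul,
      add_neg_cancel, map_zero]
  have h3 : pderiv p (conj T H q) = 0 := by
    rw [hTq, hTd, map_sub, map_sub, pderiv_C_mul,
      pderiv_C_mul, hp, hq, C_neg]
    refine (congrArg _ ?_).trans (map_zero (bind₁ (linear T.1)))
    ring
  have h4 := trace_pair hpq h1 (isNilpotent_jacobian_conj T hnil)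
  rw [h2, zero_add] at h4
  exact similarToTriangular_of_conj T (similarToTriangular_of_diag hpq h1 h2 h4 h3)

/-- Writing `a = gα`, `b = gβ` in lowest terms leaves `gα² = -βc`, so coprimality forces `β` to
divide `g`. -/
theorem exists_factorization {a b c : MvPolynomial (Fin n) K} (ha : a.IsHomogeneous 2)
    (hb : b.IsHomogeneous 2) (ha0 : a ≠ 0) (h : a * a + b * c = 0) :
    ∃ α β k, IsRelPrime α β ∧ a = k * α * β ∧ b = k * β ^ 2 ∧ c = -(k * α ^ 2) ∧ k ≠ 0 ∧
      α.IsHomogeneous α.totalDegree ∧ β.IsHomogeneous α.totalDegree ∧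
      β ≠ 0 ∧ α ≠ 0 ∧ k.totalDegree + 2 * α.totalDegree = 2 := by
  obtain ⟨α, β, g, hrel, rfl, rfl⟩ := UniqueFactorizationMonoid.exists_reduced_factors a ha0 b
  have hg0 := left_ne_zero_of_mul ha0
  have hα0 := right_ne_zero_of_mul ha0
  have h' : g * α ^ 2 + β * c = 0 := by
    apply mul_left_cancel₀ hg0
    linear_combination h
  have hdvd : β ∣ g * α ^ 2 := ⟨-c, by linear_combination h'⟩
  obtain ⟨k, rfl⟩ : β ∣ g := (hrel.symm.pow_right (n := 2)).dvd_of_dvd_mul_right hdvd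
  have hβ0 := left_ne_zero_of_mul hg0
  have hk0 := right_ne_zero_of_mul hg0
  have hb0 : β * k * β ≠ 0 := mul_ne_zero hg0 hβ0
  have d1 := ha.totalDegree ha0
  have d2 := hb.totalDegree hb0
  rw [totalDegree_mul_of_isDomain hg0 hα0, totalDegree_mul_of_isDomain hβ0 hk0] at d1
  rw [totalDegree_mul_of_isDomain hg0 hβ0, totalDegree_mul_of_isDomain hβ0 hk0] at d2
  have d3 : β.totalDegree = α.totalDegree := by omega
  refine ⟨α, β, k, hrel, by ring, by ring, ?_, hk0, ?_, ?_, hβ0, hα0, by omega⟩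
  · apply mul_left_cancel₀ hβ0
    linear_combination h'
  · rw [mul_comm] at ha ha0
    exact isHomogeneous_of_mul ha ha0
  · rw [← d3]
    rw [mul_assoc] at hb hb0
    exact isHomogeneous_of_mul hb hb0

theorem eq_zero_of_isRelPrime_of_dvd {u v : MvPolynomial (Fin n) K} {s : K}
    (hv : v.IsHomogeneous 1) (hv0 : v ≠ 0) (hrel : IsRelPrime u v) (h : v ∣ u * C s) : s = 0 := by
  by_contra hs
  have hu : v ∣ u := by
    have : u = u * C s * C s⁻¹ := by
      rw [mul_assoc, ← C_mul, mul_inv_cancel₀ hs, C_1, mul_one]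
    rw [this]
    exact h.mul_right _
  have h1 : IsUnit v := hrel hu dvd_rfl
  have h2 := (isUnit_iff_totalDegree_of_isReduced.1 h1).2
  rw [hv.totalDegree hv0] at h2
  omega

theorem similarToTriangular_or_isNormalForm_of_pair (h6 : (6 : K) ≠ 0) {H : PolyMap n K}
    (hH : ∀ i, (H i).IsHomogeneous 3) (hnil : IsNilpotent H.jacobian)
    {p q : Fin n} (hp : p.val = 0) (hq : q.val = 1) (hz : ∀ i, i ≠ p → i ≠ q → H i = 0) :
    SimilarToTriangular H.jacobian ∨
      ∃ T : Matrix.GeneralLinearGroup (Fin n) K, IsNormalForm (conj T H) := by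
  have hpq : p ≠ q := fun h => by rw [h, hq] at hp; omega
  have h2 : (C 2 : MvPolynomial (Fin n) K) ≠ 0 := by
    simpa using natCast_ne_zero_of_le_four h6 (m := 2) (by norm_num) (by norm_num)
  have h3 : (3 : K) ≠ 0 := natCast_ne_zero_of_le_four h6 (m := 3) (by norm_num) (by norm_num)
  have tr := trace_pair hpq hz hnil
  have hqq : pderiv q (H q) = -pderiv p (H p) := by linear_combination tr
  have tr2 := trace_sq_pair hpq hz hnil
  have hdet : pderiv p (H p) * pderiv p (H p) + pderiv q (H p) * pderiv p (H q) = 0 := by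
    apply mul_left_cancel₀ h2
    rw [hqq] at tr2
    rw [map_ofNat]
    linear_combination tr2
  by_cases ha0 : pderiv p (H p) = 0
  · rw [ha0] at hqq hdet
    rw [neg_zero] at hqq
    rw [zero_mul, zero_add, mul_eq_zero] at hdet
    rcases hdet with h | h
    · exact .inl (similarToTriangular_of_diag hpq.symm (fun i h h' => hz i h' h) hqq ha0 h)
    · exact .inl (similarToTriangular_of_diag hpq hz ha0 hqq h)
  obtain ⟨α, β, k, hrel, ea, eb, ec, hk0, hα, hβ, hβ0, hα0, hdeg⟩ :=
    exists_factorization (hH p).pderiv (hH p).pderiv ha0 hdet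
  rcases (by omega : α.totalDegree = 0 ∨ α.totalDegree = 1) with hd | hd
  · left
    have hα' := totalDegree_eq_zero_iff_eq_C.1 hd
    have hβ' := totalDegree_eq_zero_iff_eq_C.1 ((totalDegree_zero_iff_isHomogeneous _).2 (hd ▸ hβ))
    set x := coeff 0 α
    set y := coeff 0 β
    have hy : y ≠ 0 := fun h => hβ0 (by rw [hβ', h, C_0])
    have hxy : C (x / y) * β = α := by
      rw [hα', hβ', ← C_mul, div_mul_cancel₀ _ hy]
    refine similarToTriangular_of_proportional hpq hz hnil (κ := x / y) ?_ ?_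
    · rw [ea, eb]; linear_combination -k * β * hxy
    · rw [hqq, ea, ec]; linear_combination k * α * hxy
  right
  rw [hd] at hα hβ hdeg
  obtain ⟨κ, rfl⟩ : ∃ κ, k = C κ := ⟨_, totalDegree_eq_zero_iff_eq_C.1 (by omega)⟩
  have hκ : κ ≠ 0 := fun h => hk0 (by rw [h, C_0])
  obtain ⟨A, eA, hA⟩ := exists_eq_sum_of_isHomogeneous_one hα
  obtain ⟨B, eB, hB⟩ := exists_eq_sum_of_isHomogeneous_one hβ
  have c1 := pderiv_comm q p (H p)
  have c2 := pderiv_comm q p (H q)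
  rw [hqq] at c2
  rw [ea, eb] at c1
  rw [ea, ec] at c2
  simp only [map_neg, pderiv_mul, pderiv_C, pderiv_pow, hA, hB, mul_assoc, zero_mul, zero_add] at c1 c2
  have c1' : β * (2 * C (B p) - C (A q)) = α * C (B q) := by
    apply mul_left_cancel₀ hk0
    linear_combination -c1
  have c2' : α * (2 * C (A q) - C (B p)) = β * C (A p) := by
    apply mul_left_cancel₀ hk0
    linear_combination -c2
  -- Mixed partials give linear relations between the coprime forms `α` and `β`, so both sides
  -- vanish. The coefficients then satisfy `2 B p = A q` and `2 A q = B p`, and `3 ≠ 0` leaves only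
  -- zero.
  have Bq : B q = 0 := eq_zero_of_isRelPrime_of_dvd hβ hβ0 hrel ⟨_, c1'.symm⟩
  have Ap : A p = 0 := eq_zero_of_isRelPrime_of_dvd hα hα0 hrel.symm ⟨_, c2'.symm⟩
  rw [Bq, C_0, mul_zero] at c1'
  rw [Ap, C_0, mul_zero] at c2'
  have e1 : 2 * B p - A q = 0 := by
    apply C_injective (Fin n) K
    rw [C_sub, C_mul, map_ofNat, C_0]
    exact (mul_eq_zero.1 c1').resolve_left hβ0
  have e2 : 2 * A q - B p = 0 := by
    apply C_injective (Fin n) K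
    rw [C_sub, C_mul, map_ofNat, C_0]
    exact (mul_eq_zero.1 c2').resolve_left hα0
  have Bp : B p = 0 := (mul_eq_zero.1 (by linear_combination 2 * e1 + e2 : 3 * B p = 0)).resolve_left h3
  have Aq : A q = 0 := by linear_combination 2 * Bp - e1
  -- If all these minors vanished, `β` would divide a nonzero constant multiple of `α`, contrary to
  -- coprimality.
  obtain ⟨k, l, hΔ⟩ : ∃ k l, A k * B l - A l * B k ≠ 0 := by
    by_contra! hall
    obtain ⟨l, hl⟩ : ∃ l, B l ≠ 0 := by
      by_contra! h
      exact hβ0 (by rw [eB]; simp [h])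
    refine hl (eq_zero_of_isRelPrime_of_dvd hβ hβ0 hrel ⟨C (A l), ?_⟩)
    rw [eA, eB, Finset.sum_mul, Finset.sum_mul]
    refine Finset.sum_congr rfl fun k _ => ?_
    have := congrArg (C (σ := Fin n)) (hall k l)
    simp only [C_sub, C_mul, C_0] at this
    linear_combination X k * this
  rw [ea] at hqq
  refine exists_conj_isNormalForm hH hp hq hz hκ Ap Aq Bp Bq hΔ ?_ ?_ ?_ ?_ h6
  · rw [ea, ← eA, ← eB]
  · rw [eb, ← eB]
  · rw [ec, ← eA]
  · rw [hqq, ← eA, ← eB]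

theorem similarToTriangular_or_isNormalForm_of_eq_zero (h6 : (6 : K) ≠ 0) {H : PolyMap n K}
    (hH : ∀ i, (H i).IsHomogeneous 3) (hnil : IsNilpotent H.jacobian)
    (hz : ∀ i : Fin n, 2 ≤ i.val → H i = 0) :
    SimilarToTriangular H.jacobian ∨
      ∃ T : Matrix.GeneralLinearGroup (Fin n) K, IsNormalForm (conj T H) := by
  by_cases hn : 2 ≤ n
  · refine similarToTriangular_or_isNormalForm_of_pair h6 hH hnil (p := ⟨0, by omega⟩)
      (q := ⟨1, by omega⟩) rfl rfl fun i h0 h1 => hz i ?_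
    simp only [ne_eq, Fin.ext_iff] at h0 h1
    omega
  · exact .inl ⟨1, .inl fun i j hij => absurd hij (by have := i.2; have := j.2; omega)⟩

/-- Classification of nilpotent Jacobians of rank at most two of cubic homogeneous maps. -/
theorem similarToTriangular_or_isNormalForm (h6 : (6 : K) ≠ 0) {H : PolyMap n K}
    (hH : ∀ i, (H i).IsHomogeneous 3) (hnil : IsNilpotent H.jacobian) (hr : H.jacobianRank ≤ 2) :
    SimilarToTriangular H.jacobian ∨
      ∃ T : Matrix.GeneralLinearGroup (Fin n) K, IsNormalForm (conj T H) := by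
  by_cases h : ∃ T : Matrix.GeneralLinearGroup (Fin n) K, ∀ i : Fin n, 2 ≤ i.val → conj T H i = 0
  · obtain ⟨T, hT⟩ := h
    rcases similarToTriangular_or_isNormalForm_of_eq_zero h6 (isHomogeneous_conj T hH)
      (isNilpotent_jacobian_conj T hnil) hT with h | ⟨S, hS⟩
    · exact .inl (similarToTriangular_of_conj T h)
    · exact .inr ⟨T * S, by rwa [← conj_conj]⟩
  · left
    have hspan : ∀ T : Matrix.GeneralLinearGroup (Fin n) K,
        3 ≤ Module.finrank K (Submodule.span K (Set.range (conj T H))) := fun T => by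
      by_contra! hlt
      obtain ⟨S, hS⟩ := exists_conj_eq_zero (H := conj T H) (k := 2) (by omega)
      exact h ⟨T * S, by rwa [← conj_conj]⟩
    have h1 := hspan 1
    rw [conj_one] at h1
    obtain ⟨T, hT⟩ := exists_conj_parallel h6 hH hr h1
    exact similarToTriangular_of_conj T (similarToTriangular_of_three_le h6
      (isHomogeneous_conj T hH) (isNilpotent_jacobian_conj T hnil) (hspan T) hT)

end SmallSpan

end PolyMap

/-! ### Rank one, and consequences of the normal form. -/

namespace PolyMap

variable {K : Type*} [Field K] {n : ℕ}

theorem jacobianRank_le (H : PolyMap n K) : H.jacobianRank ≤ n := by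
  have := Matrix.rank_le_width (H.jacobian.map (algebraMap (MvPolynomial (Fin n) K)
    (FractionRing (MvPolynomial (Fin n) K))))
  exact this

theorem finrank_span_range_le_one (h6 : (6 : K) ≠ 0) {H : PolyMap n K}
    (hH : ∀ i, (H i).IsHomogeneous 3) (hr : H.jacobianRank ≤ 1) :
    Module.finrank K (Submodule.span K (Set.range H)) ≤ 1 := by
  by_cases h : ∃ i, H i ≠ 0
  · obtain ⟨i, hi⟩ := h
    refine finrank_span_range_le {H i} fun j => ?_
    obtain ⟨a, ha⟩ := eq_C_mul_of_wronskian_eq_zero h6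
      ((hH j).totalDegree_le.trans (by norm_num)) ((hH i).totalDegree_le.trans (by norm_num)) hi
      (wronskian_eq_zero h6 hH hr j i)
    rw [ha, ← smul_eq_C_mul, Finset.coe_singleton]
    exact Submodule.smul_mem _ _ (Submodule.mem_span_singleton_self _)
  · push Not at h
    exact (finrank_span_range_le ∅ fun j => by rw [h j]; exact zero_mem _).trans (by simp)

/-- Vanishing Wronskians leave a single nonzero component after conjugation, and the trace condition
says that it is free of its own variable. -/
theorem exists_conj_mem_supported (h6 : (6 : K) ≠ 0) {H : PolyMap n K}
    (hH : ∀ i, (H i).IsHomogeneous 3) (hnil : IsNilpotent H.jacobian) (hr : H.jacobianRank ≤ 1)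
    {p : Fin n} (hp : p.val = 0) :
    ∃ T : Matrix.GeneralLinearGroup (Fin n) K,
      conj T H p ∈ supported K {j : Fin n | 1 ≤ j.val} ∧
      ∀ i : Fin n, 1 ≤ i.val → conj T H i = 0 := by
  obtain ⟨T, hT⟩ := exists_conj_eq_zero (finrank_span_range_le_one h6 hH hr)
  refine ⟨T, mem_supported_of_pderiv_eq_zero h6
    ((isHomogeneous_conj T hH _).totalDegree_le.trans (by norm_num)) fun j hj => ?_, hT⟩
  have hj0 : ¬ 1 ≤ j.val := hj
  have hj1 : j = p := Fin.ext (by omega)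
  have htr := trace_eq_zero (isNilpotent_jacobian_conj T hnil)
  rw [Finset.sum_eq_single p (fun i _ hi => ?_) fun h => absurd (Finset.mem_univ _) h] at htr
  · rwa [hj1]
  · rw [hT i (Nat.one_le_iff_ne_zero.2 fun h => hi (Fin.ext (h.trans hp.symm))), map_zero]

theorem isTame_of_jacobianRank_le_one (h6 : (6 : K) ≠ 0) {H : PolyMap n K}
    (hH : ∀ i, (H i).IsHomogeneous 3) (hnil : IsNilpotent H.jacobian) (hr : H.jacobianRank ≤ 1) :
    IsTame (fun i => X i + H i : PolyMap n K) := by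
  obtain rfl | hn := Nat.eq_zero_or_pos n
  · convert isTame_X (n := 0) (K := K)
  obtain ⟨T, h0, h⟩ := exists_conj_mem_supported h6 hH hnil hr (p := ⟨0, hn⟩) rfl
  refine isTame_of_conj T (isTame_of_height Fin.val fun i => ?_)
  by_cases hi : 1 ≤ i.val
  · rw [h i hi]; exact zero_mem _
  · rw [show i = ⟨0, hn⟩ from Fin.ext (by simpa using hi)]
    exact h0

theorem IsNormalForm.isInvertible {H : PolyMap n K} (h : IsNormalForm H) :
    IsInvertible (fun i => X i + H i : PolyMap n K) := by
  obtain ⟨i₀, i₁, i₂, i₃, e0, e1, e2, e3, h0, h1, h2⟩ := h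
  have hne : ∀ {a b : Fin n} {k l : ℕ}, a.val = k → b.val = l → k ≠ l → a ≠ b :=
    fun ha hb hkl hab => hkl (by rw [← ha, ← hb, hab])
  have hs : {j : Fin n | 2 ≤ j.val} ⊆ {j : Fin n | j ≠ i₀ ∧ j ≠ i₁} := fun j (hj : 2 ≤ j.val) =>
    ⟨hne rfl e0 (by omega), hne rfl e1 (by omega)⟩
  refine isInvertible_normalForm (i₂ := i₂) (i₃ := i₃) (hne e0 e1 (by norm_num)) (hne e0 e2 (by norm_num))
    (hne e0 e3 (by norm_num)) (hne e1 e2 (by norm_num)) (hne e1 e3 (by norm_num))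
    (supported_mono hs h0) (supported_mono hs h1) (add_sub_cancel _ _).symm
    (add_sub_cancel _ _).symm fun i hi0 hi1 => h2 i ?_
  simp only [ne_eq, Fin.ext_iff] at hi0 hi1
  omega

theorem IsNormalForm.isTame {H : PolyMap n K} (h : IsNormalForm H) (h5 : 5 ≤ n) :
    IsTame (fun i => X i + H i : PolyMap n K) := by
  obtain ⟨i₀, i₁, i₂, i₃, e0, e1, e2, e3, h0, h1, h2⟩ := h
  have hne : ∀ {a b : Fin n} {k l : ℕ}, a.val = k → b.val = l → k ≠ l → a ≠ b :=
    fun ha hb hkl hab => hkl (by rw [← ha, ← hb, hab])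
  have hs : {j : Fin n | 2 ≤ j.val} ⊆ {j : Fin n | j ≠ i₀ ∧ j ≠ i₁} := fun j (hj : 2 ≤ j.val) =>
    ⟨hne rfl e0 (by omega), hne rfl e1 (by omega)⟩
  -- The fifth variable serves as the spare variable of the commutator.
  have e4 : (⟨4, h5⟩ : Fin n).val = 4 := rfl
  refine isTame_normalForm (i₂ := i₂) (i₃ := i₃) (hne e0 e1 (by norm_num)) (hne e0 e2 (by norm_num))
    (hne e0 e3 (by norm_num)) (hne e1 e2 (by norm_num)) (hne e1 e3 (by norm_num))
    (hne e0 e4 (by norm_num)) (hne e1 e4 (by norm_num))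
    (hne e2 e4 (by norm_num)) (hne e3 e4 (by norm_num))
    (supported_mono hs h0) (supported_mono hs h1) (add_sub_cancel _ _).symm
    (add_sub_cancel _ _).symm fun i hi0 hi1 => h2 i ?_
  simp only [ne_eq, Fin.ext_iff] at hi0 hi1
  omega

end PolyMap

theorem mainTheorem2 {K : Type*} [Field K] (h6 : (6 : K) ≠ 0) (n : ℕ) (H : PolyMap n K)
    (hH : ∀ i, (H i).IsHomogeneous 3) (hnil : IsNilpotent H.jacobian) :
    (H.jacobianRank = 1 →
      ∃ (hn : 1 ≤ n) (T : Matrix.GeneralLinearGroup (Fin n) K),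
        PolyMap.conj T H ⟨0, by omega⟩ ∈ MvPolynomial.supported K {j : Fin n | 1 ≤ j.val} ∧
        ∀ i : Fin n, 1 ≤ i.val → PolyMap.conj T H i = 0) ∧
    (H.jacobianRank = 2 → ¬ PolyMap.SimilarToTriangular H.jacobian →
      ∃ (hn : 4 ≤ n) (T : Matrix.GeneralLinearGroup (Fin n) K),
        let x₁ : MvPolynomial (Fin n) K := MvPolynomial.X ⟨0, by omega⟩
        let x₂ : MvPolynomial (Fin n) K := MvPolynomial.X ⟨1, by omega⟩
        let x₃ : MvPolynomial (Fin n) K := MvPolynomial.X ⟨2, by omega⟩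
        let x₄ : MvPolynomial (Fin n) K := MvPolynomial.X ⟨3, by omega⟩
        PolyMap.conj T H ⟨0, by omega⟩ - (x₁ * x₃ * x₄ - x₂ * x₄ ^ 2) ∈
          MvPolynomial.supported K {j : Fin n | 2 ≤ j.val} ∧
        PolyMap.conj T H ⟨1, by omega⟩ - (x₁ * x₃ ^ 2 - x₂ * x₃ * x₄) ∈
          MvPolynomial.supported K {j : Fin n | 2 ≤ j.val} ∧
        ∀ i : Fin n, 2 ≤ i.val → PolyMap.conj T H i = 0) ∧
    (H.jacobianRank ≤ 2 → PolyMap.IsInvertible (fun i => MvPolynomial.X i + H i)) ∧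
    (H.jacobianRank = 1 ∨ (H.jacobianRank = 2 ∧ 5 ≤ n) →
      PolyMap.IsTame (fun i => MvPolynomial.X i + H i)) := by
  refine ⟨fun hr => ?_, fun hr hT => ?_, fun hr => ?_, ?_⟩
  · have hn : 1 ≤ n := hr ▸ H.jacobianRank_le
    exact ⟨hn, PolyMap.exists_conj_mem_supported h6 hH hnil hr.le rfl⟩
  · obtain ⟨T, i₀, i₁, i₂, i₃, e0, e1, e2, e3, h⟩ :=
      (PolyMap.similarToTriangular_or_isNormalForm h6 hH hnil hr.le).resolve_left hT
    have hn : 4 ≤ n := by omega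
    rw [show i₀ = ⟨0, by omega⟩ from Fin.ext e0, show i₁ = ⟨1, by omega⟩ from Fin.ext e1,
      show i₂ = ⟨2, by omega⟩ from Fin.ext e2, show i₃ = ⟨3, by omega⟩ from Fin.ext e3] at h
    exact ⟨hn, T, h⟩
  · rcases PolyMap.similarToTriangular_or_isNormalForm h6 hH hnil hr with h | ⟨T, h⟩
    · exact (PolyMap.isTame_of_similarToTriangular h6 hH hnil h).isInvertible
    · exact PolyMap.isInvertible_of_conj T h.isInvertible
  · rintro (hr | ⟨hr, hn⟩)
    · exact PolyMap.isTame_of_jacobianRank_le_one h6 hH hnil hr.le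
    · rcases PolyMap.similarToTriangular_or_isNormalForm h6 hH hnil hr.le with h | ⟨T, h⟩
      · exact PolyMap.isTame_of_similarToTriangular h6 hH hnil h
      · exact PolyMap.isTame_of_conj T (h.isTame hn)
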